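/- For $s\in\mathbb{C}$ let \[ \mathcal{R}(s)=\int_{0\swarrow 1}\frac{x^{-s}e^{\pi i x^2}}{e^{\pi i x}-e^{-\pi i x}}\,dx \] be Riemann's auxiliary function, where $0\swarrow1$ denotes the straight line through the point $\tfrac12$ of the interval $(0,1)$, traversed in the direction $e^{-3\pi i/4}$ (from upper right to lower left), and $x^{-s}$ is the principal branch. Write $s=\sigma+it$ with $\sigma,t$ real. There exist real constants $t_0>0$ and $A>0$ such that $\mathcal{R}(s)\neq 0$ for every $s=\sigma+it$ with \[ t\ge t_0\qquad\text{and}\qquad 1-\sigma\ge A\,t^{2/5}\log t . \] This region improves Siegel's left limit $1-\sigma\ge a\,t^{3/7}$ for the zeros in the upper half plane: for every $a>0$ there is a $t_1$ such that $A\,t^{2/5}\log t<a\,t^{3/7}$ for all $t\ge t_1$, so that every $\sigma+it$ with $t\ge \max(t_0,t_1)$ and $1-\sigma\ge a\,t^{3/7}$ lies in the zero-free region. -/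

import Mathlib

open Complex MeasureTheory

/-- The path `0 ↙ 1`: the straight line through the point `1/2` of the interval `(0, 1)`,
traversed with constant unit velocity `exp (-3πi/4)`, that is, from the upper right
(`u → -∞`) to the lower left (`u → +∞`). It never meets the cut `(-∞, 0]` of the
principal branch. -/
noncomputable def auxPath (u : ℝ) : ℂ :=
  1 / 2 + (u : ℂ) * exp (-(3 * (Real.pi : ℂ) * I / 4))

/-- The integrand `x ^ (-s) * e ^ (π i x ^ 2) / (e ^ (π i x) - e ^ (-π i x))`, where
`x ^ (-s)` is the principal branch. -/
noncomputable def auxIntegrand (s x : ℂ) : ℂ :=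
  x ^ (-s) * exp ((Real.pi : ℂ) * I * x ^ 2) /
    (exp ((Real.pi : ℂ) * I * x) - exp (-((Real.pi : ℂ) * I * x)))

/-- Riemann's auxiliary function
`R(s) = ∫_{0 ↙ 1} x ^ (-s) e ^ (π i x ^ 2) / (e ^ (π i x) - e ^ (-π i x)) dx`,
an absolutely convergent contour integral for every complex `s`. -/
noncomputable def riemannAux (s : ℂ) : ℂ :=
  ∫ u : ℝ, auxIntegrand s (auxPath u) * exp (-(3 * (Real.pi : ℂ) * I / 4))

/-!
Write `s = 2 π i η ^ 2` with `0 < Im η < Re η`, so that `x ^ (-s) * e ^ (π i x ^ 2)` has a saddle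
point at `η`, and move the contour to the line through `0` in the direction `e ^ (π i / 4)`. In the
upper half plane `1 / (e ^ (π i x) - e ^ (-π i x))` is `-∑ e ^ (π i (2 k + 1) x)`, and the saddle
point evaluates the `k`-th of the resulting integrals as `a * c_k * q ^ (2 k + 1)`, where
`q = e ^ (π i η)` and `c_k = e ^ (-π i (2 k + 1) ^ 2 / 8)`. As `c_1 = -c_0` and `c_(k+2) = -c_k`,
these main terms add up to `a * c_0 * (q - q ^ 3) / (1 + q ^ 4)`, of modulus at least `|a q| d / 2`
with `d = 1 - |q| ^ 2`, while the errors of the saddle point evaluations add up to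
`O(|a q| / (|η| d ^ 4))`. So `riemannAux s` does not vanish once `|η| d ^ 5` is large. Away from the
diagonal `Re η = Im η`, `d` is comparable to `min (Im η) 1`, `-Re s` to `|η| Im η` and `Im s` to
`|η| ^ 2`, so `|η| d ^ 5` is large when `1 - Re s` is at least a large multiple of
`(Im s) ^ (2 / 5)`; the factor `log (Im s)` pays for truncating the sum. Near the diagonal `q` is so
small that the term `k = 0` dominates.
-/

section

open Set Filter Topology
open scoped Real

section ContourShifts

variable {E : Type*} [NormedAddCommGroup E] [NormedSpace ℂ E]

theorem integrable_exp_neg_abs : Integrable fun u : ℝ => Real.exp (-|u|) := by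
  rw [← integrableOn_univ, ← Iic_union_Ioi (a := (0 : ℝ))]
  refine IntegrableOn.union ?_ ?_
  · refine (integrableOn_exp_Iic 0).congr_fun (fun x hx => ?_) measurableSet_Iic
    simp only [abs_of_nonpos (show x ≤ 0 from hx), neg_neg]
  · refine (integrableOn_exp_neg_Ioi 0).congr_fun (fun x hx => ?_) measurableSet_Ioi
    simp only [abs_of_pos (show 0 < x from hx)]

theorem tendsto_exp_neg_abs_cocompact :
    Tendsto (fun u : ℝ => Real.exp (-|u|)) (cocompact ℝ) (𝓝 0) :=
  Real.tendsto_exp_neg_atTop_nhds_zero.comp tendsto_norm_cocompact_atTop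

theorem tendsto_integral_vertical_zero {F : ℂ → E} {g : ℝ → ℝ} {a b : ℝ} (hab : a ≤ b)
    {l : Filter ℝ} (hg : Tendsto g l (𝓝 0))
    (hF : ∀ u v : ℝ, a ≤ v → v ≤ b → ‖F (u + v * I)‖ ≤ g u) :
    Tendsto (fun T : ℝ => ∫ v in a..b, F (T + v * I)) l (𝓝 0) := by
  refine squeeze_zero_norm (a := fun T => g T * |b - a|) (fun T => ?_)
    (by simpa using hg.mul_const |b - a|)
  refine intervalIntegral.norm_integral_le_of_norm_le_const fun v hv => ?_
  rw [uIoc_of_le hab] at hv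
  exact hF T v hv.1.le hv.2

theorem integral_horizontal_eq {F : ℂ → E} {g : ℝ → ℝ} {a b : ℝ} (hab : a ≤ b)
    (hc : ContinuousOn F {z | a ≤ z.im ∧ z.im ≤ b})
    (hd : DifferentiableOn ℂ F {z | a < z.im ∧ z.im < b})
    (hg : Integrable g) (hg0 : Tendsto g (cocompact ℝ) (𝓝 0))
    (hF : ∀ u v : ℝ, a ≤ v → v ≤ b → ‖F (u + v * I)‖ ≤ g u) :
    ∫ u : ℝ, F (u + a * I) = ∫ u : ℝ, F (u + b * I) := by
  have hlim (v : ℝ) (hav : a ≤ v) (hvb : v ≤ b) :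
      Tendsto (fun T : ℝ => ∫ u in (-T)..T, F (u + v * I)) atTop (𝓝 (∫ u : ℝ, F (u + v * I))) := by
    refine intervalIntegral_tendsto_integral (hg.mono' ?_ ?_) tendsto_neg_atTop_atBot tendsto_id
    · refine (hc.comp_continuous (by fun_prop) fun u => ?_).aestronglyMeasurable
      simp [hav, hvb]
    · exact Eventually.of_forall fun u => hF u v hav hvb
  have hright : Tendsto (fun T : ℝ => ∫ v in a..b, F (T + v * I)) atTop (𝓝 0) :=
    tendsto_integral_vertical_zero hab (hg0.mono_left atTop_le_cocompact) hF
  have hleft : Tendsto (fun T : ℝ => ∫ v in a..b, F ((-T : ℝ) + v * I)) atTop (𝓝 0) :=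
    (tendsto_integral_vertical_zero hab (hg0.mono_left atBot_le_cocompact) hF).comp
      tendsto_neg_atTop_atBot
  have hrect (T : ℝ) : (∫ u in (-T)..T, F (u + a * I)) - (∫ u in (-T)..T, F (u + b * I))
      + I • (∫ v in a..b, F (T + v * I)) - I • (∫ v in a..b, F ((-T : ℝ) + v * I)) = 0 := by
    have := integral_boundary_rect_eq_zero_of_continuousOn_of_differentiableOn F
      ((-T : ℝ) + a * I) ((T : ℝ) + b * I) (hc.mono fun z hz => ?_) (hd.mono fun z hz => ?_)
    · simpa using this
    · simpa [mem_reProdIm, uIcc_of_le hab] using hz.2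
    · simpa [mem_reProdIm, hab] using hz.2
  have hzero := (((hlim a le_rfl hab).sub (hlim b hab le_rfl)).add (hright.const_smul I)).sub
    (hleft.const_smul I)
  simp only [hrect, smul_zero, add_zero, sub_zero] at hzero
  exact sub_eq_zero.1 (tendsto_nhds_unique tendsto_const_nhds hzero).symm

theorem integral_Ioi_zero_eq_integral_exp {E : Type*} [NormedAddCommGroup E] [NormedSpace ℝ E]
    (f : ℝ → E) : ∫ u in Ioi (0 : ℝ), f u = ∫ v : ℝ, Real.exp v • f (Real.exp v) := by
  rw [← Real.range_exp, ← image_univ, integral_image_eq_integral_abs_deriv_smul MeasurableSet.univ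
    (fun x _ => (Real.hasDerivAt_exp x).hasDerivWithinAt) Real.exp_injective.injOn]
  simp

/-- In the coordinate `log x`, rotating a ray is shifting a horizontal line. -/
theorem integral_ray_eq {F : ℂ → ℂ} {g : ℝ → ℝ} {a b : ℝ} (hab : a ≤ b)
    (hd : ∀ w : ℂ, a ≤ w.im → w.im ≤ b → DifferentiableAt ℂ F (exp w))
    (hg : Integrable g) (hg0 : Tendsto g (cocompact ℝ) (𝓝 0))
    (hF : ∀ u v : ℝ, a ≤ v → v ≤ b → ‖F (exp (u + v * I))‖ ≤ g u * Real.exp (-u)) :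
    (∫ u in Ioi (0 : ℝ), F (exp (a * I) * u)) * exp (a * I) =
      (∫ u in Ioi (0 : ℝ), F (exp (b * I) * u)) * exp (b * I) := by
  have hlog (v : ℝ) : (∫ u in Ioi (0 : ℝ), F (exp (v * I) * u)) * exp (v * I) =
      ∫ u : ℝ, F (exp (u + v * I)) * exp (u + v * I) := by
    rw [integral_Ioi_zero_eq_integral_exp, ← integral_mul_const]
    refine integral_congr_ae (Eventually.of_forall fun u => ?_)
    simp only [exp_add, ofReal_exp, real_smul]
    rw [mul_comm (exp (v * I)) (exp u)]
    ring
  have hdiff (w : ℂ) (haw : a ≤ w.im) (hwb : w.im ≤ b) :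
      DifferentiableAt ℂ (fun w => F (exp w) * exp w) w :=
    ((hd w haw hwb).comp w differentiable_exp.differentiableAt).mul
      differentiable_exp.differentiableAt
  rw [hlog, hlog]
  refine integral_horizontal_eq (F := fun w => F (exp w) * exp w) hab
    (fun w hw => (hdiff w hw.1 hw.2).continuousAt.continuousWithinAt)
    (fun w hw => (hdiff w hw.1.le hw.2.le).differentiableWithinAt) hg hg0 fun u v hav hvb => ?_
  calc ‖F (exp (u + v * I)) * exp (u + v * I)‖
      ≤ g u * Real.exp (-u) * ‖exp (u + v * I)‖ := by
        rw [norm_mul]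
        gcongr
        exact hF u v hav hvb
    _ = g u := by
        rw [norm_exp, mul_assoc, ← Real.exp_add]
        simp

end ContourShifts

section GaussianOnLowerStrip

/-- `G` is holomorphic on the strip `-b ≤ Im z ≤ 0` except perhaps at `0`, where it vanishes to
some positive (real) order, and has Gaussian decay along the strip. Under these hypotheses the
line of integration may be moved up to a branch point at `0`. -/
structure IsGaussianOnLowerStrip (G : ℂ → ℂ) (b : ℝ) : Prop where
  map_zero : G 0 = 0
  differentiableAt : ∀ z : ℂ, -b ≤ z.im → z.im ≤ 0 → z ≠ 0 → DifferentiableAt ℂ G z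
  exists_bound : ∃ M k c d : ℝ, 0 < k ∧ 0 < d ∧ ∀ z : ℂ, -b ≤ z.im → z.im ≤ 0 → z ≠ 0 →
    ‖G z‖ ≤ M * ‖z‖ ^ k * Real.exp (c * |z.re| - d * z.re ^ 2)

theorem rpow_le_exp_mul_sub_one {x k : ℝ} (hx : 0 ≤ x) (hk : 0 ≤ k) :
    x ^ k ≤ Real.exp (k * (x - 1)) :=
  calc x ^ k ≤ (Real.exp (x - 1)) ^ k :=
        Real.rpow_le_rpow hx (by linarith [Real.add_one_le_exp (x - 1)]) hk
    _ = Real.exp (k * (x - 1)) := by rw [← Real.exp_mul, mul_comm]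

theorem mul_abs_sub_mul_sq_le (k : ℝ) {d : ℝ} (hd : 0 < d) (u : ℝ) :
    k * |u| - d * u ^ 2 ≤ (k + 1) ^ 2 / (4 * d) - |u| := by
  have hsq : 0 ≤ (k + 1 - 2 * d * |u|) ^ 2 / (4 * d) := by positivity
  have hexpand : (k + 1 - 2 * d * |u|) ^ 2 / (4 * d) =
      (k + 1) ^ 2 / (4 * d) - (k + 1) * |u| + d * |u| ^ 2 := by
    field_simp
    ring
  rw [sq_abs] at hexpand
  linarith

namespace IsGaussianOnLowerStrip

variable {G : ℂ → ℂ} {b : ℝ}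

theorem exists_norm_le_exp_neg_abs (hG : IsGaussianOnLowerStrip G b) :
    ∃ C : ℝ, ∀ u v : ℝ, -b ≤ v → v ≤ 0 → ‖G (u + v * I)‖ ≤ C * Real.exp (-|u|) := by
  obtain ⟨M, k, c, d, hk, hd, hbound⟩ := hG.exists_bound
  refine ⟨|M| * Real.exp (k * b + (k + c + 1) ^ 2 / (4 * d)), fun u v hbv hv => ?_⟩
  rcases eq_or_ne (u + v * I : ℂ) 0 with hz | hz
  · rw [hz, hG.map_zero, norm_zero]
    positivity
  have hnorm : ‖(u + v * I : ℂ)‖ ≤ |u| + b := by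
    have := norm_le_abs_re_add_abs_im (u + v * I : ℂ)
    simp only [add_re, ofReal_re, re_ofReal_mul, I_re, add_im, ofReal_im, im_ofReal_mul, I_im,
      mul_zero, mul_one, add_zero, zero_add, abs_of_nonpos hv] at this
    linarith
  have hpow : ‖(u + v * I : ℂ)‖ ^ k ≤ Real.exp (k * (|u| + b)) :=
    (rpow_le_exp_mul_sub_one (norm_nonneg _) hk.le).trans
      (Real.exp_le_exp.2 (mul_le_mul_of_nonneg_left (by linarith) hk.le))
  calc ‖G (u + v * I)‖ ≤ M * ‖(u + v * I : ℂ)‖ ^ k * Real.exp (c * |u| - d * u ^ 2) := by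
        simpa using hbound (u + v * I) (by simpa) (by simpa) hz
    _ ≤ |M| * Real.exp (k * (|u| + b)) * Real.exp (c * |u| - d * u ^ 2) := by
        gcongr
        exact le_abs_self M
    _ ≤ |M| * Real.exp (k * b + (k + c + 1) ^ 2 / (4 * d)) * Real.exp (-|u|) := by
        rw [mul_assoc, mul_assoc, ← Real.exp_add, ← Real.exp_add]
        gcongr |M| * Real.exp ?_
        linarith [mul_abs_sub_mul_sq_le (k + c) hd u]

theorem continuousOn (hG : IsGaussianOnLowerStrip G b) :
    ContinuousOn G {z | -b ≤ z.im ∧ z.im ≤ 0} := by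
  rintro z ⟨hbz, hz⟩
  rcases eq_or_ne z 0 with rfl | h0
  · obtain ⟨M, k, c, d, hk, -, hbound⟩ := hG.exists_bound
    have hcont : ContinuousAt
        (fun w : ℂ => M * ‖w‖ ^ k * Real.exp (c * |w.re| - d * w.re ^ 2)) 0 := by
      have := continuous_norm.continuousAt (x := (0 : ℂ)) |>.rpow_const (p := k) (Or.inr hk.le)
      fun_prop
    have hlim := hcont.tendsto
    simp only [norm_zero, Real.zero_rpow hk.ne', mul_zero, zero_mul] at hlim
    rw [ContinuousWithinAt, hG.map_zero]
    refine squeeze_zero_norm' ?_ (hlim.mono_left nhdsWithin_le_nhds)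
    filter_upwards [self_mem_nhdsWithin] with w hw
    rcases eq_or_ne w 0 with rfl | hw0
    · simp [hG.map_zero, Real.zero_rpow hk.ne']
    · exact hbound w hw.1 hw.2 hw0
  · exact (hG.differentiableAt z hbz hz h0).continuousAt.continuousWithinAt

theorem mono (hG : IsGaussianOnLowerStrip G b) {b' : ℝ} (hb : b' ≤ b) :
    IsGaussianOnLowerStrip G b' := by
  obtain ⟨M, k, c, d, hk, hd, hbound⟩ := hG.exists_bound
  exact ⟨hG.map_zero, fun z hz => hG.differentiableAt z (by linarith),
    M, k, c, d, hk, hd, fun z hz => hbound z (by linarith)⟩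

theorem integrable_sub_mul_I (hG : IsGaussianOnLowerStrip G b) (hb : 0 ≤ b) :
    Integrable fun u : ℝ => G (u - b * I) := by
  obtain ⟨C, hC⟩ := hG.exists_norm_le_exp_neg_abs
  refine (integrable_exp_neg_abs.const_mul C).mono' ?_ (Eventually.of_forall fun u => ?_)
  · exact (hG.continuousOn.comp_continuous (f := fun u : ℝ => (u : ℂ) - b * I) (by fun_prop)
      fun u => by simpa using hb).aestronglyMeasurable
  · simpa [sub_eq_add_neg] using hC u (-b) le_rfl (by simpa using hb)

theorem integrable (hG : IsGaussianOnLowerStrip G b) (hb : 0 ≤ b) :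
    Integrable fun u : ℝ => G u := by
  simpa using (hG.mono hb).integrable_sub_mul_I le_rfl

theorem integral_sub_mul_I (hG : IsGaussianOnLowerStrip G b) (hb : 0 ≤ b) :
    ∫ u : ℝ, G (u - b * I) = ∫ u : ℝ, G u := by
  obtain ⟨C, hC⟩ := hG.exists_norm_le_exp_neg_abs
  have hdiff : DifferentiableOn ℂ G {z | -b < z.im ∧ z.im < 0} := fun z hz =>
    (hG.differentiableAt z hz.1.le hz.2.le (by rintro rfl; simp at hz)).differentiableWithinAt
  have hshift := integral_horizontal_eq (a := -b) (b := 0) (by linarith) hG.continuousOn hdiff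
    (integrable_exp_neg_abs.const_mul C)
    (by simpa using tendsto_exp_neg_abs_cocompact.const_mul C) hC
  simpa [sub_eq_add_neg] using hshift

end IsGaussianOnLowerStrip

end GaussianOnLowerStrip

section IntegrandFactors

/-- The primitive eighth root of unity `e ^ (π i / 4)`, the direction of steepest descent of
`e ^ (π i x ^ 2)`; the path `0 ↙ 1` runs in the direction `-zeta8`. -/
noncomputable def zeta8 : ℂ := exp ((π / 4 : ℝ) * I)

/-- The numerator `x ^ (-s) * e ^ (π i x ^ 2)` of the integrand of `riemannAux`. -/
noncomputable def auxNumer (s x : ℂ) : ℂ := x ^ (-s) * exp ((π : ℂ) * I * x ^ 2)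

/-- The denominator `e ^ (π i x) - e ^ (-π i x) = 2 i sin (π x)` of the integrand of
`riemannAux`. -/
noncomputable def auxDenom (x : ℂ) : ℂ := exp ((π : ℂ) * I * x) - exp (-((π : ℂ) * I * x))

/-- The `m`-th mode `x ^ (-s) * e ^ (π i x ^ 2) * e ^ (π i m x)`. Expanding `1 / auxDenom` in powers
of `e ^ (π i x)` writes the integrand of `riemannAux` as a combination of modes with odd `m`. -/
noncomputable def auxMode (s : ℂ) (m : ℝ) (x : ℂ) : ℂ :=
  auxNumer s x * exp ((π : ℂ) * I * (m * x))

variable {s x z : ℂ} {m : ℝ}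

theorem auxIntegrand_eq_div (s x : ℂ) : auxIntegrand s x = auxNumer s x / auxDenom x := rfl

theorem zeta8_eq : zeta8 = ((√2 / 2 : ℝ) : ℂ) + ((√2 / 2 : ℝ) : ℂ) * I := by
  rw [zeta8, exp_mul_I, ← ofReal_cos, ← ofReal_sin, Real.cos_pi_div_four, Real.sin_pi_div_four]

theorem norm_zeta8 : ‖zeta8‖ = 1 := norm_exp_ofReal_mul_I _

theorem zeta8_ne_zero : zeta8 ≠ 0 := exp_ne_zero _

theorem zeta8_sq : zeta8 ^ 2 = I := by
  rw [zeta8, ← exp_nat_mul, show ((2 : ℕ) : ℂ) * (((π / 4 : ℝ) : ℂ) * I) = π / 2 * I by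
    push_cast; ring, exp_pi_div_two_mul_I]

theorem exp_neg_three_pi_div_four : exp (-(3 * (π : ℂ) * I / 4)) = -zeta8 := by
  rw [zeta8, show -(3 * (π : ℂ) * I / 4) = ((π / 4 : ℝ) : ℂ) * I - π * I by push_cast; ring,
    exp_sub, exp_pi_mul_I, div_neg, div_one]

theorem zeta8_mul_re (z : ℂ) : (zeta8 * z).re = √2 / 2 * (z.re - z.im) := by
  simp [zeta8_eq]; ring

theorem zeta8_mul_im (z : ℂ) : (zeta8 * z).im = √2 / 2 * (z.re + z.im) := by
  simp [zeta8_eq]; ring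

theorem zeta8_mul_mem_slitPlane (hz : z.im ≤ 0) (h0 : z ≠ 0) : zeta8 * z ∈ slitPlane := by
  have hsqrt : 0 < √2 / 2 := by positivity
  rw [mem_slitPlane_iff, zeta8_mul_re, zeta8_mul_im]
  by_contra! hcut
  have hsum : z.re + z.im = 0 := (mul_eq_zero.1 hcut.2).resolve_left hsqrt.ne'
  have hdiff : z.re - z.im ≤ 0 := nonpos_of_mul_nonpos_right hcut.1 hsqrt
  exact h0 (Complex.ext (by simp; linarith) (by simp; linarith))

theorem norm_exp_pi_I_mul (x : ℂ) : ‖exp ((π : ℂ) * I * x)‖ = Real.exp (-(π * x.im)) := by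
  simp [norm_exp]

theorem norm_exp_neg_pi_I_mul (x : ℂ) : ‖exp (-((π : ℂ) * I * x))‖ = Real.exp (π * x.im) := by
  simp [norm_exp]

theorem auxNumer_zero (hs : s.re < 0) : auxNumer s 0 = 0 := by
  rw [auxNumer, zero_cpow (neg_ne_zero.2 (by rintro rfl; simp at hs)), zero_mul]

theorem auxNumer_ne_zero (hx : x ≠ 0) : auxNumer s x ≠ 0 :=
  mul_ne_zero (by simp [cpow_eq_zero_iff, hx]) (exp_ne_zero _)

theorem norm_auxNumer (hx : x ≠ 0) : ‖auxNumer s x‖ =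
    ‖x‖ ^ (-s.re) * Real.exp (s.im * arg x - 2 * π * (x.re * x.im)) := by
  rw [auxNumer, norm_mul, norm_cpow_of_ne_zero hx, norm_exp, neg_re, neg_im, div_eq_mul_inv,
    ← Real.exp_neg, mul_assoc, ← Real.exp_add]
  congr 2
  simp [pow_two]
  ring

theorem differentiableAt_auxNumer (hx : x ∈ slitPlane) : DifferentiableAt ℂ (auxNumer s) x :=
  (differentiableAt_id.cpow_const hx).mul (by fun_prop)

theorem differentiable_auxDenom : Differentiable ℂ auxDenom := by
  unfold auxDenom
  fun_prop

theorem differentiableAt_auxMode (hx : x ∈ slitPlane) : DifferentiableAt ℂ (auxMode s m) x :=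
  (differentiableAt_auxNumer hx).mul (by fun_prop)

theorem differentiableAt_auxIntegrand (hx : x ∈ slitPlane) (hden : auxDenom x ≠ 0) :
    DifferentiableAt ℂ (auxIntegrand s) x :=
  (differentiableAt_auxNumer hx).fun_div (differentiable_auxDenom x) hden

end IntegrandFactors

section DenominatorBounds

variable {x z : ℂ}

theorem exp_sub_exp_le_norm_auxDenom (x : ℂ) :
    Real.exp (π * |x.im|) - Real.exp (-(π * |x.im|)) ≤ ‖auxDenom x‖ := by
  have hpos := norm_sub_norm_le (exp ((π : ℂ) * I * x)) (exp (-((π : ℂ) * I * x)))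
  have hneg := norm_sub_norm_le (exp (-((π : ℂ) * I * x))) (exp ((π : ℂ) * I * x))
  rw [norm_exp_pi_I_mul, norm_exp_neg_pi_I_mul] at hpos hneg
  rw [norm_sub_rev] at hneg
  rcases abs_cases x.im with ⟨habs, _⟩ | ⟨habs, _⟩ <;> rw [habs]
  · exact hneg
  · simpa [auxDenom] using hpos

theorem two_pi_mul_abs_im_le_norm_auxDenom (x : ℂ) : 2 * π * |x.im| ≤ ‖auxDenom x‖ := by
  refine le_trans ?_ (exp_sub_exp_le_norm_auxDenom x)
  have hsinh : π * |x.im| ≤ Real.sinh (π * |x.im|) := Real.self_le_sinh_iff.2 (by positivity)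
  rw [Real.sinh_eq] at hsinh
  linarith

theorem two_mul_abs_sin_le_norm_auxDenom (x : ℂ) : 2 * |Real.sin (π * x.re)| ≤ ‖auxDenom x‖ := by
  have him : (auxDenom x).im =
      (Real.exp (-(π * x.im)) + Real.exp (π * x.im)) * Real.sin (π * x.re) := by
    simp [auxDenom, exp_im]
    ring
  have hcosh := Real.one_le_cosh (π * x.im)
  rw [Real.cosh_eq] at hcosh
  refine le_trans ?_ (abs_im_le_norm _)
  rw [him, abs_mul, abs_of_pos (by positivity : 0 < Real.exp (-(π * x.im)) + Real.exp (π * x.im))]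
  gcongr
  linarith

theorem two_thirds_mul_abs_le_abs_sin_pi_mul {r : ℝ} (hr : |r| ≤ 3 / 4) :
    2 / 3 * |r| ≤ |Real.sin (π * r)| := by
  wlog hpos : 0 ≤ r generalizing r
  · simpa using this (r := -r) (by simpa using hr) (by linarith)
  have hpi := Real.pi_pos
  rw [abs_of_nonneg hpos] at hr ⊢
  refine le_trans ?_ (le_abs_self _)
  rcases le_total r (1 / 2) with hhalf | hhalf
  · have := Real.mul_le_sin (x := π * r) (by positivity) (by nlinarith)
    rw [← mul_assoc, div_mul_cancel₀ _ hpi.ne'] at this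
    linarith
  · have := Real.mul_le_sin (x := π * (1 - r)) (by nlinarith) (by nlinarith)
    rw [← mul_assoc, div_mul_cancel₀ _ hpi.ne', mul_one_sub π r, Real.sin_pi_sub] at this
    linarith

/-- The strip contains the zero `0` of `auxDenom` but no other integer. -/
theorem half_norm_le_norm_auxDenom (h0 : 0 ≤ x.re - x.im) (h1 : x.re - x.im ≤ 1 / 2) :
    ‖x‖ / 2 ≤ ‖auxDenom x‖ := by
  have hx := norm_le_abs_re_add_abs_im x
  have him : 6 * |x.im| ≤ ‖auxDenom x‖ :=
    le_trans (by gcongr; linarith [Real.pi_gt_three]) (two_pi_mul_abs_im_le_norm_auxDenom x)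
  have hdist : |x.re| ≤ |x.im| + 1 / 2 := by
    have := abs_sub_abs_le_abs_sub x.re x.im
    rw [abs_of_nonneg h0] at this
    linarith
  rcases le_or_gt |x.im| (1 / 4) with hsmall | hlarge
  · have hsin := two_thirds_mul_abs_le_abs_sin_pi_mul (r := x.re) (by linarith)
    linarith [two_mul_abs_sin_le_norm_auxDenom x, abs_nonneg x.re, abs_nonneg x.im]
  · linarith

theorem half_norm_le_norm_auxDenom_zeta8_mul (hz : -(√2 / 4) ≤ z.im) (hz' : z.im ≤ 0) :
    ‖z‖ / 2 ≤ ‖auxDenom (zeta8 * z)‖ := by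
  have hsq : √2 * √2 = 2 := Real.mul_self_sqrt (by norm_num)
  have hwidth : (zeta8 * z).re - (zeta8 * z).im = √2 * -z.im := by
    rw [zeta8_mul_re, zeta8_mul_im]
    ring
  have := half_norm_le_norm_auxDenom (x := zeta8 * z)
    (by rw [hwidth]; exact mul_nonneg (by positivity) (by linarith))
    (by rw [hwidth]; nlinarith [Real.sqrt_nonneg 2])
  rwa [norm_mul, norm_zeta8, one_mul] at this

theorem auxDenom_zeta8_mul_ne_zero (hz : -(√2 / 4) ≤ z.im) (hz' : z.im ≤ 0) (h0 : z ≠ 0) :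
    auxDenom (zeta8 * z) ≠ 0 :=
  norm_pos_iff.1 <| (half_pos (norm_pos_iff.2 h0)).trans_le
    (half_norm_le_norm_auxDenom_zeta8_mul hz hz')

theorem auxDenom_zeta8_mul_ofReal_ne_zero {u : ℝ} (hu : u ≠ 0) : auxDenom (zeta8 * u) ≠ 0 :=
  auxDenom_zeta8_mul_ne_zero (by rw [ofReal_im]; exact neg_nonpos.2 (by positivity))
    (ofReal_im u).le (ofReal_ne_zero.2 hu)

end DenominatorBounds

section StripBounds

variable {s z : ℂ} {m b : ℝ}

theorem norm_auxNumer_zeta8_mul_le (ht : 0 ≤ s.im) (hz : -b ≤ z.im) (hz' : z.im ≤ 0)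
    (h0 : z ≠ 0) : ‖auxNumer s (zeta8 * z)‖ ≤
      ‖z‖ ^ (-s.re) * Real.exp (π * s.im + π * b ^ 2 - π * z.re ^ 2) := by
  have harg : s.im * arg (zeta8 * z) ≤ s.im * π := by gcongr; exact arg_le_pi _
  have him : z.im ^ 2 ≤ b ^ 2 := by nlinarith
  have hprod : (zeta8 * z).re * (zeta8 * z).im = (z.re ^ 2 - z.im ^ 2) / 2 := by
    rw [zeta8_mul_re, zeta8_mul_im]
    linear_combination (z.re ^ 2 - z.im ^ 2) / 4 * Real.sq_sqrt (show (0 : ℝ) ≤ 2 by norm_num)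
  rw [norm_auxNumer (mul_ne_zero zeta8_ne_zero h0), norm_mul, norm_zeta8, one_mul, hprod]
  gcongr _ * Real.exp ?_
  nlinarith [Real.pi_pos]

theorem norm_exp_pi_I_mul_zeta8_mul_le (hm : 0 ≤ m) (hz : -b ≤ z.im) (hz' : z.im ≤ 0) :
    ‖exp ((π : ℂ) * I * (m * (zeta8 * z)))‖ ≤ Real.exp (π * m * (|z.re| + b)) := by
  have hsqrt : √2 / 2 ≤ 1 := by
    nlinarith [Real.sqrt_nonneg 2, Real.sq_sqrt (show (0 : ℝ) ≤ 2 by norm_num)]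
  have him : -(zeta8 * z).im ≤ |z.re| + b :=
    calc -(zeta8 * z).im = √2 / 2 * (-z.re + -z.im) := by rw [zeta8_mul_im]; ring
      _ ≤ √2 / 2 * (|z.re| + b) := by gcongr; exacts [neg_le_abs _, by linarith]
      _ ≤ |z.re| + b := mul_le_of_le_one_left (by linarith [abs_nonneg z.re]) hsqrt
  rw [norm_exp_pi_I_mul, im_ofReal_mul, Real.exp_le_exp]
  linarith [mul_le_mul_of_nonneg_left him (mul_nonneg Real.pi_pos.le hm)]

theorem isGaussianOnLowerStrip_auxMode (ht : 0 ≤ s.im) (hs : s.re < 0) (hm : 0 ≤ m) (b : ℝ) :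
    IsGaussianOnLowerStrip (fun z => auxMode s m (zeta8 * z)) b where
  map_zero := by simp [auxMode, auxNumer_zero hs]
  differentiableAt z _ hz' h0 :=
    (differentiableAt_auxMode (zeta8_mul_mem_slitPlane hz' h0)).comp z
      (differentiableAt_id.const_mul zeta8)
  exists_bound := by
    refine ⟨Real.exp (π * s.im + π * b ^ 2 + π * m * b), -s.re, π * m, π, by linarith, Real.pi_pos,
      fun z hz hz' h0 => ?_⟩
    calc ‖auxMode s m (zeta8 * z)‖
        ≤ (‖z‖ ^ (-s.re) * Real.exp (π * s.im + π * b ^ 2 - π * z.re ^ 2)) *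
            Real.exp (π * m * (|z.re| + b)) := by
          rw [auxMode, norm_mul]
          gcongr
          · exact norm_auxNumer_zeta8_mul_le ht hz hz' h0
          · exact norm_exp_pi_I_mul_zeta8_mul_le hm hz hz'
      _ = _ := by
          rw [mul_assoc (‖z‖ ^ _), ← Real.exp_add, mul_comm (Real.exp _) (‖z‖ ^ _),
            mul_assoc (‖z‖ ^ _), ← Real.exp_add]
          ring_nf

theorem isGaussianOnLowerStrip_auxIntegrand (ht : 0 ≤ s.im) (hs : s.re < -1) :
    IsGaussianOnLowerStrip (fun z => auxIntegrand s (zeta8 * z)) (√2 / 4) where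
  map_zero := by simp [auxIntegrand_eq_div, auxNumer_zero (show s.re < 0 by linarith)]
  differentiableAt z hz hz' h0 :=
    (differentiableAt_auxIntegrand (zeta8_mul_mem_slitPlane hz' h0)
      (auxDenom_zeta8_mul_ne_zero hz hz' h0)).comp z (differentiableAt_id.const_mul zeta8)
  exists_bound := by
    refine ⟨2 * Real.exp (π * s.im + π * (√2 / 4) ^ 2), -s.re - 1, 0, π, by linarith, Real.pi_pos,
      fun z hz hz' h0 => ?_⟩
    have hnorm : 0 < ‖z‖ := norm_pos_iff.2 h0
    calc ‖auxIntegrand s (zeta8 * z)‖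
        ≤ (‖z‖ ^ (-s.re) * Real.exp (π * s.im + π * (√2 / 4) ^ 2 - π * z.re ^ 2)) / (‖z‖ / 2) := by
          rw [auxIntegrand_eq_div, norm_div]
          gcongr
          · exact norm_auxNumer_zeta8_mul_le ht hz hz' h0
          · exact half_norm_le_norm_auxDenom_zeta8_mul hz hz'
      _ = _ := by
          rw [Real.rpow_sub_one hnorm.ne', zero_mul, zero_sub, sub_eq_add_neg, Real.exp_add]
          field_simp

theorem zeta8_mul_sub_mul_I (u : ℝ) :
    zeta8 * ((u + √2 / 4 : ℝ) - (√2 / 4 : ℝ) * I) = 1 / 2 + u * zeta8 := by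
  have hsqrt : ((√2 : ℝ) : ℂ) ^ 2 = 2 := by
    rw [← ofReal_pow, Real.sq_sqrt (by norm_num)]
    norm_num
  rw [zeta8_eq]
  push_cast
  linear_combination (1 / 8 - I ^ 2 / 8) * hsqrt - I_sq / 4

theorem riemannAux_eq_neg_integral (ht : 0 ≤ s.im) (hs : s.re < -1) :
    riemannAux s = -((∫ u : ℝ, auxIntegrand s (zeta8 * u)) * zeta8) := by
  have hshift := (isGaussianOnLowerStrip_auxIntegrand ht hs).integral_sub_mul_I (by positivity)
  rw [← hshift, ← integral_add_right_eq_self _ (√2 / 4)]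
  simp only [zeta8_mul_sub_mul_I]
  rw [riemannAux, integral_mul_const, exp_neg_three_pi_div_four, mul_neg, ← integral_neg_eq_self]
  simp only [auxPath, exp_neg_three_pi_div_four]
  simp

end StripBounds

section ModeExpansion

/-- The integral of the `m`-th mode over the ray from `0` in the direction `zeta8`. -/
noncomputable def rayTerm (s : ℂ) (m : ℝ) : ℂ :=
  (∫ u in Ioi (0 : ℝ), auxMode s m (zeta8 * u)) * zeta8

/-- The remainder on the ray from `0` in the direction `zeta8` after the first `K` modes of the
expansion of `1 / auxDenom` have been removed. -/
noncomputable def rayTail (s : ℂ) (K : ℕ) : ℂ :=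
  (∫ u in Ioi (0 : ℝ), exp ((π : ℂ) * I * ((2 * K : ℝ) * (zeta8 * u))) *
    auxIntegrand s (zeta8 * u)) * zeta8

/-- The integral over the half of the line `zeta8 * ℝ` in the third quadrant, where no expansion
is made. -/
noncomputable def lowerPart (s : ℂ) : ℂ :=
  (∫ u in Iic (0 : ℝ), auxIntegrand s (zeta8 * u)) * zeta8

variable {s x : ℂ}

theorem inv_sub_inv_eq_sub_sum {𝕜 : Type*} [Field 𝕜] {q : 𝕜} (hq : q ≠ 0) (h : q - q⁻¹ ≠ 0)
    (K : ℕ) :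
    (q - q⁻¹)⁻¹ = q ^ (2 * K) * (q - q⁻¹)⁻¹ - ∑ k ∈ Finset.range K, q ^ (2 * k + 1) := by
  induction K with
  | zero => simp
  | succ n ih =>
    have hpow : q ^ (2 * (n + 1)) = q ^ (2 * n) + q ^ (2 * n + 1) * (q - q⁻¹) := by
      rw [mul_sub, pow_succ q (2 * n), mul_inv_cancel_right₀ hq]
      ring
    rw [Finset.sum_range_succ, hpow, add_mul, mul_inv_cancel_right₀ h]
    linear_combination ih

theorem auxIntegrand_eq_sub_sum_auxMode (hx : auxDenom x ≠ 0) (s : ℂ) (K : ℕ) :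
    auxIntegrand s x = exp ((π : ℂ) * I * ((2 * K : ℝ) * x)) * auxIntegrand s x -
      ∑ k ∈ Finset.range K, auxMode s (2 * k + 1) x := by
  have hpow (m : ℕ) : exp ((π : ℂ) * I * x) ^ m = exp ((π : ℂ) * I * ((m : ℝ) * x)) := by
    rw [← exp_nat_mul]
    push_cast
    ring_nf
  have hden : auxDenom x = exp ((π : ℂ) * I * x) - (exp ((π : ℂ) * I * x))⁻¹ := by
    rw [auxDenom, exp_neg]
  have hexpand := inv_sub_inv_eq_sub_sum (exp_ne_zero _) (hden ▸ hx) K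
  simp only [← hden, hpow] at hexpand
  push_cast at hexpand
  simp only [auxIntegrand_eq_div, auxMode, div_eq_mul_inv, ← Finset.mul_sum]
  push_cast
  linear_combination auxNumer s x * hexpand

theorem riemannAux_eq_sum_rayTerm_sub (ht : 0 ≤ s.im) (hs : s.re < -1) (K : ℕ) :
    riemannAux s = (∑ k ∈ Finset.range K, rayTerm s (2 * k + 1)) - rayTail s K - lowerPart s := by
  have hint : Integrable fun u : ℝ => auxIntegrand s (zeta8 * u) :=
    (isGaussianOnLowerStrip_auxIntegrand ht hs).integrable (by positivity)
  have hmode (k : ℕ) : Integrable fun u : ℝ => auxMode s (2 * k + 1) (zeta8 * u) :=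
    (isGaussianOnLowerStrip_auxMode ht (by linarith) (by positivity) 0).integrable le_rfl
  have hsum := integrable_finsetSum (Finset.range K) fun k _ => hmode k
  have hexpand : ∀ u ∈ Ioi (0 : ℝ), auxIntegrand s (zeta8 * u) =
      exp ((π : ℂ) * I * ((2 * K : ℝ) * (zeta8 * u))) * auxIntegrand s (zeta8 * u) -
        ∑ k ∈ Finset.range K, auxMode s (2 * k + 1) (zeta8 * u) := fun u hu =>
    auxIntegrand_eq_sub_sum_auxMode (auxDenom_zeta8_mul_ofReal_ne_zero (ne_of_gt hu)) s K
  have htail : IntegrableOn (fun u : ℝ => exp ((π : ℂ) * I * ((2 * K : ℝ) * (zeta8 * u))) *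
      auxIntegrand s (zeta8 * u)) (Ioi 0) :=
    (hint.integrableOn.add hsum.integrableOn).congr_fun
      (fun u hu => eq_sub_iff_add_eq.1 (hexpand u hu)) measurableSet_Ioi
  rw [riemannAux_eq_neg_integral ht hs, ← intervalIntegral.integral_Iic_add_Ioi
    hint.integrableOn hint.integrableOn (b := 0), setIntegral_congr_fun measurableSet_Ioi hexpand,
    integral_sub htail hsum.integrableOn, integral_finsetSum _ fun k _ => (hmode k).integrableOn]
  simp only [rayTerm, rayTail, lowerPart]
  rw [add_mul, sub_mul, Finset.sum_mul]
  ring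

end ModeExpansion

section RayRotation

variable {s η : ℂ} {u v m : ℝ}

theorem arg_pos_of_im_pos (h : 0 < η.im) : 0 < arg η :=
  (arg_nonneg_iff.2 h.le).lt_of_ne fun h0 => h.ne' (arg_eq_zero_iff.1 h0.symm).2

theorem arg_eq_arctan (h : 0 < η.re) : arg η = Real.arctan (η.im / η.re) := by
  have habs := abs_lt.1 (abs_arg_lt_pi_div_two_iff.2 (Or.inl h))
  rw [← tan_arg, Real.arctan_tan habs.1 habs.2]

theorem arg_lt_pi_div_four (h0 : 0 < η.re) (h1 : η.im < η.re) : arg η < π / 4 := by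
  rw [arg_eq_arctan h0, ← Real.arctan_one, Real.arctan_lt_arctan_iff, div_lt_one h0]
  exact h1

theorem sin_two_arg_pos (h0 : 0 < η.im) (h1 : η.im < η.re) : 0 < Real.sin (2 * arg η) :=
  Real.sin_pos_of_pos_of_lt_pi (by linarith [arg_pos_of_im_pos h0])
    (by linarith [arg_lt_pi_div_four (h0.trans h1) h1, Real.pi_pos])

theorem integral_ray_rotate {F : ℂ → ℂ} {C : ℝ} (h0 : 0 < η.im) (h1 : η.im < η.re)
    (hd : ∀ x : ℂ, 0 < x.re → 0 < x.im → DifferentiableAt ℂ F x)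
    (hF : ∀ u v : ℝ, arg η ≤ v → v ≤ π / 4 →
      ‖F (exp (u + v * I))‖ ≤ C * Real.exp (-u - |u|)) :
    (∫ u in Ioi (0 : ℝ), F (zeta8 * u)) * zeta8 = (∫ u in Ioi (0 : ℝ), F (η * u)) * η := by
  have harg0 := arg_pos_of_im_pos h0
  have harg := arg_lt_pi_div_four (h0.trans h1) h1
  have hη : 0 < ‖η‖ := norm_pos_iff.2 (by rintro rfl; simp at h0)
  have hrotate : (∫ u in Ioi (0 : ℝ), F (exp (arg η * I) * u)) * exp (arg η * I) =
      (∫ u in Ioi (0 : ℝ), F (zeta8 * u)) * zeta8 := by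
    refine integral_ray_eq harg.le (fun w hw hw' => hd _ ?_ ?_)
      (integrable_exp_neg_abs.const_mul C)
      (by simpa using tendsto_exp_neg_abs_cocompact.const_mul C) fun u v hv hv' =>
        (hF u v hv hv').trans_eq ?_
    · rw [exp_re]
      exact mul_pos (Real.exp_pos _)
        (Real.cos_pos_of_mem_Ioo ⟨by linarith, by linarith [Real.pi_pos]⟩)
    · rw [exp_im]
      exact mul_pos (Real.exp_pos _)
        (Real.sin_pos_of_pos_of_lt_pi (by linarith) (by linarith [Real.pi_pos]))
    · rw [mul_assoc, ← Real.exp_add, neg_add_eq_sub, sub_eq_add_neg, add_comm, ← sub_eq_add_neg]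
  have hscale : ∫ u in Ioi (0 : ℝ), F (exp (arg η * I) * u) =
      ‖η‖ * ∫ u in Ioi (0 : ℝ), F (η * u) := by
    have hcomp := integral_comp_mul_left_Ioi (fun u : ℝ => F (exp (arg η * I) * u)) 0 hη
    rw [mul_zero, real_smul, ofReal_inv, eq_inv_mul_iff_mul_eq₀ (ofReal_ne_zero.2 hη.ne')] at hcomp
    rw [← hcomp]
    simp only [ofReal_mul, mul_left_comm (exp (arg η * I)), ← mul_assoc, norm_mul_exp_arg_mul_I]
  rw [← hrotate, hscale, mul_right_comm, norm_mul_exp_arg_mul_I, mul_comm]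

theorem norm_auxNumer_exp (h0 : -π < v) (h1 : v ≤ π) : ‖auxNumer s (exp (u + v * I))‖ =
    Real.exp (-s.re * u + s.im * v - π * (Real.exp (2 * u) * Real.sin (2 * v))) := by
  have hdouble : ((2 : ℕ) : ℂ) * (u + v * I) = ((2 * u : ℝ) : ℂ) + ((2 * v : ℝ) : ℂ) * I := by
    push_cast
    ring
  rw [auxNumer, cpow_def_of_ne_zero (exp_ne_zero _),
    log_exp (by simpa using h0) (by simpa using h1), ← exp_nat_mul, ← exp_add, norm_exp, hdouble]
  congr 1
  simp [exp_im]
  ring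

theorem norm_auxNumer_exp_le (h0 : 0 < η.im) (ht : 0 ≤ s.im) (hv : arg η ≤ v) (hv' : v ≤ π / 4) :
    ‖auxNumer s (exp (u + v * I))‖ ≤
      Real.exp (-s.re * u + s.im * π - π * Real.sin (2 * arg η) * Real.exp (2 * u)) := by
  have harg := arg_pos_of_im_pos h0
  have hsin : Real.sin (2 * arg η) ≤ Real.sin (2 * v) :=
    Real.sin_le_sin_of_le_of_le_pi_div_two (by linarith) (by linarith) (by linarith)
  rw [norm_auxNumer_exp (by linarith) (by linarith), Real.exp_le_exp, mul_assoc π,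
    mul_comm (Real.sin _)]
  gcongr
  linarith

theorem mul_sub_exp_two_mul_le {k c : ℝ} (hk : 0 ≤ k) (hc : 0 < c) (u : ℝ) :
    k * u - c * Real.exp (2 * u) ≤ (k + 2) ^ 2 / (8 * c) - u - |u| := by
  have hconst : 0 ≤ (k + 2) ^ 2 / (8 * c) := by positivity
  rcases le_or_gt 0 u with hu | hu
  · have hexp : 2 * u ^ 2 ≤ Real.exp (2 * u) := by
      linarith [Real.quadratic_le_exp_of_nonneg (x := 2 * u) (by positivity)]
    have hsquare := mul_abs_sub_mul_sq_le (k + 1) (mul_pos hc two_pos) u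
    rw [abs_of_nonneg hu, show k + 1 + 1 = k + 2 by ring, show 4 * (c * 2) = 8 * c by ring]
      at hsquare
    rw [abs_of_nonneg hu]
    linarith [mul_le_mul_of_nonneg_left hexp hc.le]
  · rw [abs_of_neg hu]
    have : 0 ≤ c * Real.exp (2 * u) := by positivity
    linarith [mul_nonpos_of_nonneg_of_nonpos hk hu.le]

theorem exp_mul_sin_arg_le_im_exp (h0 : 0 < η.im) (hv : arg η ≤ v) (hv' : v ≤ π / 4) (u : ℝ) :
    Real.exp u * Real.sin (arg η) ≤ (exp (u + v * I)).im := by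
  have hsin : Real.sin (arg η) ≤ Real.sin v :=
    Real.sin_le_sin_of_le_of_le_pi_div_two (by linarith [arg_pos_of_im_pos h0, Real.pi_pos])
      (by linarith [Real.pi_pos]) hv
  simpa [exp_im] using mul_le_mul_of_nonneg_left hsin (Real.exp_pos u).le

theorem im_exp_nonneg (h0 : 0 < η.im) (hv : arg η ≤ v) (hv' : v ≤ π / 4) (u : ℝ) :
    0 ≤ (exp (u + v * I)).im :=
  (mul_nonneg (Real.exp_pos u).le (Real.sin_nonneg_of_nonneg_of_le_pi (arg_pos_of_im_pos h0).le
    (arg_le_pi η))).trans (exp_mul_sin_arg_le_im_exp h0 hv hv' u)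

theorem norm_exp_pi_I_mul_le_one (hm : 0 ≤ m) {x : ℂ} (hx : 0 ≤ x.im) :
    ‖exp ((π : ℂ) * I * (m * x))‖ ≤ 1 := by
  rw [norm_exp_pi_I_mul, im_ofReal_mul, Real.exp_le_one_iff, neg_nonpos]
  positivity

theorem rayTerm_eq_rotate (h0 : 0 < η.im) (h1 : η.im < η.re) (ht : 0 ≤ s.im) (hs : s.re ≤ 0)
    (hm : 0 ≤ m) : rayTerm s m = (∫ u in Ioi (0 : ℝ), auxMode s m (η * u)) * η := by
  have hsin := mul_pos Real.pi_pos (sin_two_arg_pos h0 h1)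
  refine integral_ray_rotate
    (C := Real.exp (s.im * π + (-s.re + 2) ^ 2 / (8 * (π * Real.sin (2 * arg η))))) h0 h1
    (fun x hx _ => differentiableAt_auxMode (Or.inl hx)) fun u v hv hv' => ?_
  calc ‖auxMode s m (exp (u + v * I))‖
      ≤ Real.exp (-s.re * u + s.im * π - π * Real.sin (2 * arg η) * Real.exp (2 * u)) * 1 := by
        rw [auxMode, norm_mul]
        gcongr
        · exact norm_auxNumer_exp_le h0 ht hv hv'
        · exact norm_exp_pi_I_mul_le_one hm (im_exp_nonneg h0 hv hv' u)
    _ ≤ _ := by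
        rw [mul_one, ← Real.exp_add, Real.exp_le_exp]
        linarith [mul_sub_exp_two_mul_le (k := -s.re) (by linarith) hsin u]

theorem norm_auxIntegrand_exp_le (h0 : 0 < η.im) (h1 : η.im < η.re) (ht : 0 ≤ s.im)
    (hs : s.re ≤ -1) (hv : arg η ≤ v) (hv' : v ≤ π / 4) :
    ‖auxIntegrand s (exp (u + v * I))‖ ≤
      Real.exp (s.im * π + ((-s.re - 1) + 2) ^ 2 / (8 * (π * Real.sin (2 * arg η)))) /
        (2 * π * Real.sin (arg η)) * Real.exp (-u - |u|) := by
  have hpi := Real.pi_pos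
  have hsin_two := mul_pos hpi (sin_two_arg_pos h0 h1)
  have hsin : 0 < Real.sin (arg η) :=
    Real.sin_pos_of_pos_of_lt_pi (arg_pos_of_im_pos h0) (by linarith)
  have hden : 2 * π * (Real.exp u * Real.sin (arg η)) ≤ ‖auxDenom (exp (u + v * I))‖ :=
    le_trans (by gcongr; exact (exp_mul_sin_arg_le_im_exp h0 hv hv' u).trans (le_abs_self _))
      (two_pi_mul_abs_im_le_norm_auxDenom _)
  calc ‖auxIntegrand s (exp (u + v * I))‖
      ≤ Real.exp (-s.re * u + s.im * π - π * Real.sin (2 * arg η) * Real.exp (2 * u)) /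
          (2 * π * (Real.exp u * Real.sin (arg η))) := by
        rw [auxIntegrand_eq_div, norm_div]
        gcongr
        exact norm_auxNumer_exp_le h0 ht hv hv'
    _ = Real.exp (-s.re * u + s.im * π - π * Real.sin (2 * arg η) * Real.exp (2 * u) - u) /
          (2 * π * Real.sin (arg η)) := by
        rw [Real.exp_sub _ u]
        field_simp
    _ ≤ _ := by
        rw [div_mul_eq_mul_div, ← Real.exp_add]
        gcongr
        linarith [mul_sub_exp_two_mul_le (k := -s.re - 1) (by linarith) hsin_two u]

theorem rayTail_eq_rotate (h0 : 0 < η.im) (h1 : η.im < η.re) (ht : 0 ≤ s.im) (hs : s.re ≤ -1)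
    (K : ℕ) : rayTail s K =
      (∫ u in Ioi (0 : ℝ), exp ((π : ℂ) * I * ((2 * K : ℝ) * (η * u))) *
        auxIntegrand s (η * u)) * η := by
  refine integral_ray_rotate
    (F := fun x => exp ((π : ℂ) * I * ((2 * K : ℝ) * x)) * auxIntegrand s x)
    (C := Real.exp (s.im * π + ((-s.re - 1) + 2) ^ 2 / (8 * (π * Real.sin (2 * arg η)))) /
      (2 * π * Real.sin (arg η))) h0 h1
    (fun x hx hx' => DifferentiableAt.mul (by fun_prop)
      (differentiableAt_auxIntegrand (Or.inl hx) ?_)) fun u v hv hv' => ?_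
  · have : 0 < 2 * π * |x.im| := by positivity
    exact norm_pos_iff.1 (this.trans_le (two_pi_mul_abs_im_le_norm_auxDenom x))
  · rw [norm_mul]
    exact (mul_le_of_le_one_left (norm_nonneg _) (norm_exp_pi_I_mul_le_one (by positivity)
      (im_exp_nonneg h0 hv hv' u))).trans (norm_auxIntegrand_exp_le h0 h1 ht hs hv hv')

end RayRotation

section SaddleParam

/-- The parameter `s = 2 π i η ^ 2` for which `x ^ (-s) * e ^ (π i x ^ 2)` has a saddle point
at `η`. -/
noncomputable def saddleParam (η : ℂ) : ℂ := 2 * (π : ℂ) * I * η ^ 2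

variable {η : ℂ} {u : ℝ}

theorem saddleParam_re (η : ℂ) : (saddleParam η).re = -(4 * π * (η.re * η.im)) := by
  simp [saddleParam, pow_two]
  ring

theorem saddleParam_im (η : ℂ) : (saddleParam η).im = 2 * π * (η.re ^ 2 - η.im ^ 2) := by
  simp [saddleParam, pow_two]

theorem saddleParam_im_nonneg (h0 : 0 < η.im) (h1 : η.im < η.re) : 0 ≤ (saddleParam η).im := by
  have : 0 ≤ η.re ^ 2 - η.im ^ 2 := by nlinarith
  rw [saddleParam_im]
  positivity

theorem saddleParam_re_lt_neg_one (h : 1 ≤ η.re * η.im) : (saddleParam η).re < -1 := by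
  rw [saddleParam_re]
  nlinarith [Real.pi_gt_three]

theorem ne_zero_of_im_pos (h : 0 < η.im) : η ≠ 0 := by
  rintro rfl
  simp at h

theorem norm_sq_eq_re_sq_add_im_sq (z : ℂ) : ‖z‖ ^ 2 = z.re ^ 2 + z.im ^ 2 := by
  rw [Complex.sq_norm, normSq_apply, sq, sq]

theorem one_le_norm_of_one_le_re_mul_im (h : 1 ≤ η.re * η.im) : 1 ≤ ‖η‖ := by
  rw [← one_le_sq_iff₀ (norm_nonneg η), norm_sq_eq_re_sq_add_im_sq]
  nlinarith [sq_nonneg (η.re - η.im)]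

theorem norm_auxNumer_mul_ofReal (s : ℂ) (hη : η ≠ 0) (hu : 0 < u) :
    ‖auxNumer s (η * u)‖ = ‖auxNumer s η‖ *
      (u ^ (-s.re) * Real.exp (-(2 * π * (η.re * η.im) * (u ^ 2 - 1)))) := by
  rw [norm_auxNumer (mul_ne_zero hη (ofReal_ne_zero.2 hu.ne')), norm_auxNumer hη, norm_mul,
    norm_real, Real.norm_of_nonneg hu.le, Real.mul_rpow (norm_nonneg _) hu.le, arg_mul_real hu,
    re_mul_ofReal, im_mul_ofReal, show s.im * arg η - 2 * π * (η.re * u * (η.im * u)) =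
      (s.im * arg η - 2 * π * (η.re * η.im)) + -(2 * π * (η.re * η.im) * (u ^ 2 - 1)) by ring,
    Real.exp_add]
  ring

end SaddleParam

section Gaussian

theorem integrable_exp_neg_mul_sub_sq {b : ℝ} (hb : 0 < b) (c : ℝ) :
    Integrable fun x : ℝ => Real.exp (-b * (x - c) ^ 2) :=
  (integrable_exp_neg_mul_sq hb).comp_sub_right c

theorem integral_exp_neg_mul_sub_sq (b c : ℝ) :
    ∫ x : ℝ, Real.exp (-b * (x - c) ^ 2) = √(π / b) := by
  rw [integral_sub_right_eq_self (fun x : ℝ => Real.exp (-b * x ^ 2)) c, integral_gaussian]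

theorem norm_integral_Ioi_gaussian_le {E : Type*} [NormedAddCommGroup E] [NormedSpace ℝ E]
    {f : ℝ → E} {A b c : ℝ} (hb : 0 < b) (hA : 0 ≤ A)
    (hf : ∀ u, 0 < u → ‖f u‖ ≤ A * Real.exp (-b * (u - c) ^ 2)) :
    ‖∫ u in Ioi (0 : ℝ), f u‖ ≤ A * √(π / b) := by
  have hint := (integrable_exp_neg_mul_sub_sq hb c).const_mul A
  calc ‖∫ u in Ioi (0 : ℝ), f u‖ ≤ ∫ u in Ioi (0 : ℝ), A * Real.exp (-b * (u - c) ^ 2) :=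
        norm_integral_le_of_norm_le hint.integrableOn
          ((ae_restrict_iff' measurableSet_Ioi).2 (Eventually.of_forall hf))
    _ ≤ ∫ u : ℝ, A * Real.exp (-b * (u - c) ^ 2) :=
        setIntegral_le_integral hint (Eventually.of_forall fun u => by
          simp only [Pi.zero_apply]; positivity)
    _ = A * √(π / b) := by rw [integral_const_mul, integral_exp_neg_mul_sub_sq]

end Gaussian

section RayTailBound

variable {s η : ℂ} {u : ℝ} {K : ℕ}

theorem norm_auxIntegrand_mul_ofReal_le (h0 : 0 < η.im) (hs : s.re ≤ -1) (hu : 0 < u) :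
    ‖auxIntegrand s (η * u)‖ ≤ ‖auxNumer s η‖ / (2 * π * η.im) *
      Real.exp ((-s.re - 1) * (u - 1) - 2 * π * (η.re * η.im) * (u ^ 2 - 1)) := by
  have hden := two_pi_mul_abs_im_le_norm_auxDenom (η * u)
  rw [im_mul_ofReal, abs_of_pos (by positivity)] at hden
  have hpow := rpow_le_exp_mul_sub_one (x := u) (k := -s.re - 1) hu.le (by linarith)
  rw [auxIntegrand_eq_div, norm_div, norm_auxNumer_mul_ofReal s (ne_zero_of_im_pos h0) hu,
    ← sub_add_cancel (-s.re) 1, Real.rpow_add_one hu.ne']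
  calc _ ≤ ‖auxNumer s η‖ * (Real.exp ((-s.re - 1) * (u - 1)) * u *
          Real.exp (-(2 * π * (η.re * η.im) * (u ^ 2 - 1)))) / (2 * π * (η.im * u)) := by
        gcongr
    _ = _ := by
        rw [sub_eq_add_neg (_ * (u - 1)), Real.exp_add, add_sub_cancel_right]
        field_simp

/-- The slack is `π y (x (u - 1) + K) ^ 2 / x ≥ 0`, where `η = x + i y`. -/
theorem tail_exponent_le (h0 : 0 < η.im) (h1 : 0 < η.re) (hK : (K : ℝ) ≤ η.re / 2) (hu : 0 < u) :
    -(π * (2 * K * (η.im * u))) +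
        ((-(saddleParam η).re - 1) * (u - 1) - 2 * π * (η.re * η.im) * (u ^ 2 - 1)) ≤
      1 + -(3 / 2 * π * K * η.im) + -(π * (η.re * η.im)) * (u - 1) ^ 2 := by
  have hsq : 0 ≤ π * η.im * (η.re * (u - 1) + K) ^ 2 / η.re := by positivity
  have hexpand : π * η.im * (η.re * (u - 1) + K) ^ 2 / η.re =
      π * (η.re * η.im) * (u - 1) ^ 2 + 2 * π * K * η.im * (u - 1) +
        π * η.im * K * (K / η.re) := by
    field_simp
    ring
  have hratio : π * η.im * K * (K / η.re) ≤ π * η.im * K * (1 / 2) :=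
    mul_le_mul_of_nonneg_left (by rw [div_le_iff₀ h1]; linarith) (by positivity)
  rw [saddleParam_re]
  linarith

theorem norm_rayTail_le (h0 : 0 < η.im) (h1 : η.im < η.re) (h2 : 1 ≤ η.re * η.im)
    (hK : (K : ℝ) ≤ η.re / 2) : ‖rayTail (saddleParam η) K‖ ≤
      ‖auxNumer (saddleParam η) η‖ * (‖η‖ / η.im) * Real.exp (-(3 / 2 * π * K * η.im)) := by
  have hpi := Real.pi_gt_three
  have hb : 1 ≤ π * (η.re * η.im) := by nlinarith
  have hs := (saddleParam_re_lt_neg_one h2).le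
  set A := ‖auxNumer (saddleParam η) η‖ / (2 * π * η.im) *
    Real.exp (1 + -(3 / 2 * π * K * η.im)) with hA
  have hbound : ∀ u : ℝ, 0 < u → ‖exp ((π : ℂ) * I * ((2 * K : ℝ) * (η * u))) *
      auxIntegrand (saddleParam η) (η * u)‖ ≤
        A * Real.exp (-(π * (η.re * η.im)) * (u - 1) ^ 2) := by
    intro u hu
    rw [norm_mul, norm_exp_pi_I_mul, im_ofReal_mul, im_mul_ofReal]
    calc _ ≤ Real.exp (-(π * (2 * K * (η.im * u)))) * (‖auxNumer (saddleParam η) η‖ /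
          (2 * π * η.im) * Real.exp ((-(saddleParam η).re - 1) * (u - 1) -
            2 * π * (η.re * η.im) * (u ^ 2 - 1))) := by
          gcongr
          exact norm_auxIntegrand_mul_ofReal_le h0 hs hu
      _ ≤ _ := by
          rw [hA, mul_left_comm, ← Real.exp_add, mul_assoc _ (Real.exp _), ← Real.exp_add]
          gcongr _ * Real.exp ?_
          exact tail_exponent_le h0 (h0.trans h1) hK hu
  have hsqrt : √(π / (π * (η.re * η.im))) ≤ 1 := by
    rw [div_mul_cancel_left₀ Real.pi_ne_zero, Real.sqrt_le_one]
    exact inv_le_one_of_one_le₀ h2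
  have hexp : Real.exp 1 / (2 * π) ≤ 1 := by
    rw [div_le_one (by positivity)]
    linarith [Real.exp_one_lt_three]
  rw [rayTail_eq_rotate h0 h1 (saddleParam_im_nonneg h0 h1) hs, norm_mul]
  calc _ ≤ A * √(π / (π * (η.re * η.im))) * ‖η‖ := by
        gcongr
        exact norm_integral_Ioi_gaussian_le (by linarith) (by positivity) hbound
    _ ≤ A * 1 * ‖η‖ := by gcongr
    _ = (‖auxNumer (saddleParam η) η‖ * (‖η‖ / η.im) * Real.exp (-(3 / 2 * π * K * η.im))) *
        (Real.exp 1 / (2 * π)) := by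
        rw [hA, Real.exp_add]
        field_simp
    _ ≤ _ := mul_le_of_le_one_right (by positivity) hexp

end RayTailBound

section LowerPartBound

variable {s η : ℂ} {u : ℝ}

theorem norm_auxNumer_neg_zeta8_mul (s : ℂ) (hu : 0 < u) :
    ‖auxNumer s (zeta8 * (-u : ℝ))‖ =
      u ^ (-s.re) * Real.exp (-(3 / 4 * π * s.im) - π * u ^ 2) := by
  have hpi := Real.pi_pos
  have hpolar : zeta8 * (-u : ℝ) = exp ((Real.log u : ℝ) + (-(3 * π / 4) : ℝ) * I) := by
    rw [exp_add, ← ofReal_exp, Real.exp_log hu, show ((-(3 * π / 4) : ℝ) : ℂ) * I =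
      -(3 * (π : ℂ) * I / 4) by push_cast; ring, exp_neg_three_pi_div_four]
    push_cast
    ring
  have hsin : Real.sin (2 * (-(3 * π / 4))) = 1 := by
    rw [show 2 * (-(3 * π / 4)) = π / 2 - 2 * π by ring, Real.sin_sub_two_pi, Real.sin_pi_div_two]
  rw [hpolar, norm_auxNumer_exp (by linarith) (by linarith), hsin, mul_one, two_mul, Real.exp_add,
    Real.exp_log hu, Real.rpow_def_of_pos hu, ← Real.exp_add]
  ring_nf

theorem inv_exp_sub_exp_neg_le {v : ℝ} (hv : 0 < v) :
    (Real.exp v - Real.exp (-v))⁻¹ ≤ Real.exp (-v) * (1 + 1 / (2 * v)) := by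
  have hlt : Real.exp (-v) < Real.exp v := Real.exp_lt_exp.2 (by linarith)
  have hsq : (2 * v + 1) * Real.exp (-v) ≤ Real.exp v :=
    calc (2 * v + 1) * Real.exp (-v) ≤ Real.exp (2 * v) * Real.exp (-v) := by
          gcongr
          exact Real.add_one_le_exp _
      _ = Real.exp v := by rw [← Real.exp_add]; ring_nf
  have hprod : Real.exp (-v) * Real.exp v = 1 := by rw [← Real.exp_add]; simp
  rw [inv_le_iff_one_le_mul₀ (by linarith),
    show 1 + 1 / (2 * v) = (2 * v + 1) / (2 * v) by field_simp, mul_div_assoc', div_mul_eq_mul_div,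
    one_le_div₀ (by positivity)]
  nlinarith [mul_le_mul_of_nonneg_left hsq (Real.exp_pos (-v)).le]

theorem rpow_le_rpow_mul_exp {r k : ℝ} (hu : 0 ≤ u) (hr : 0 < r) (hk : 0 ≤ k) :
    u ^ k ≤ r ^ k * Real.exp (k * (u / r - 1)) :=
  calc u ^ k = r ^ k * (u / r) ^ k := by
        rw [← Real.mul_rpow hr.le (by positivity), mul_div_cancel₀ _ hr.ne']
    _ ≤ _ := by
        gcongr
        exact rpow_le_exp_mul_sub_one (by positivity) hk

theorem rpow_mul_one_add_le {r k : ℝ} (hu : 0 < u) (hr : 1 ≤ r) (hk : 1 ≤ k) :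
    u ^ k * (1 + 1 / (4 * u)) ≤ 2 * (r ^ k * Real.exp (k * (u / r - 1))) := by
  have hexp : Real.exp ((k - 1) * (u / r - 1)) ≤ 4 * Real.exp (k * (u / r - 1)) :=
    calc Real.exp ((k - 1) * (u / r - 1)) ≤ Real.exp (1 + k * (u / r - 1)) := by
          have : 0 ≤ u / r := by positivity
          rw [Real.exp_le_exp]
          linarith
      _ ≤ 4 * Real.exp (k * (u / r - 1)) := by
          rw [Real.exp_add]
          gcongr
          linarith [Real.exp_one_lt_three]
  have hlower : u ^ (k - 1) ≤ 4 * (r ^ k * Real.exp (k * (u / r - 1))) :=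
    calc u ^ (k - 1) ≤ r ^ (k - 1) * Real.exp ((k - 1) * (u / r - 1)) :=
          rpow_le_rpow_mul_exp hu.le (by linarith) (by linarith)
      _ ≤ r ^ k * (4 * Real.exp (k * (u / r - 1))) := by
          gcongr
          linarith
      _ = _ := by ring
  have hsplit : u ^ k * (1 + 1 / (4 * u)) = u ^ k + u ^ (k - 1) / 4 := by
    rw [Real.rpow_sub_one hu.ne']
    field_simp
  rw [hsplit]
  linarith [rpow_le_rpow_mul_exp (k := k) hu.le (by linarith : 0 < r) (by linarith)]

theorem rpow_mul_exp_le_norm_auxNumer (h0 : 0 < η.im) (ht : 0 ≤ s.im) :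
    ‖η‖ ^ (-s.re) * Real.exp (-(2 * π * (η.re * η.im))) ≤ ‖auxNumer s η‖ := by
  rw [norm_auxNumer (ne_zero_of_im_pos h0)]
  gcongr
  linarith [mul_nonneg ht (arg_pos_of_im_pos h0).le]

/-- The exponent of the bound for `auxIntegrand (saddleParam η)` at `-zeta8 * u`, relative to
`auxNumer (saddleParam η) η`. -/
noncomputable def lowerExponent (η : ℂ) (u : ℝ) : ℝ :=
  2 * π * (η.re * η.im) * (2 * (u / ‖η‖) - 1) - π * u ^ 2 - π * (√2 / 2 * u) -
    3 / 4 * π * (saddleParam η).im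

theorem norm_inv_auxDenom_neg_zeta8_mul_le (hu : 0 < u) :
    ‖auxDenom (zeta8 * (-u : ℝ))‖⁻¹ ≤ Real.exp (-(π * (√2 / 2 * u))) * (1 + 1 / (4 * u)) := by
  set v := π * (√2 / 2 * u) with hv
  have hv_pos : 0 < v := by positivity
  have hden := exp_sub_exp_le_norm_auxDenom (zeta8 * (-u : ℝ))
  rw [show (zeta8 * (-u : ℝ)).im = -(√2 / 2 * u) by rw [zeta8_mul_im]; simp, abs_neg,
    abs_of_pos (by positivity), ← hv] at hden
  have huv : 2 * u ≤ v := by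
    have hsqrt : (4 / 3 : ℝ) ≤ √2 := Real.le_sqrt_of_sq_le (by norm_num)
    calc 2 * u = 3 * (4 / 3 / 2 * u) := by ring
      _ ≤ v := by rw [hv]; gcongr; exact Real.pi_gt_three.le
  have hlt : Real.exp (-v) < Real.exp v := Real.exp_lt_exp.2 (by linarith)
  calc ‖auxDenom (zeta8 * (-u : ℝ))‖⁻¹ ≤ (Real.exp v - Real.exp (-v))⁻¹ := by gcongr
    _ ≤ Real.exp (-v) * (1 + 1 / (2 * v)) := inv_exp_sub_exp_neg_le hv_pos
    _ ≤ Real.exp (-v) * (1 + 1 / (4 * u)) := by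
        have : 1 / (2 * v) ≤ 1 / (4 * u) := one_div_le_one_div_of_le (by positivity) (by linarith)
        gcongr

theorem norm_auxIntegrand_neg_zeta8_mul_le (h0 : 0 < η.im) (h1 : η.im < η.re)
    (h2 : 1 ≤ η.re * η.im) (hu : 0 < u) :
    ‖auxIntegrand (saddleParam η) (zeta8 * (-u : ℝ))‖ ≤
      2 * ‖auxNumer (saddleParam η) η‖ * Real.exp (lowerExponent η u) := by
  set k := -(saddleParam η).re with hk
  have hk_one : 1 ≤ k := by linarith [saddleParam_re_lt_neg_one h2]
  set w := -(3 / 4 * π * (saddleParam η).im) - π * u ^ 2 - π * (√2 / 2 * u) with hw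
  calc ‖auxIntegrand (saddleParam η) (zeta8 * (-u : ℝ))‖
      ≤ u ^ k * Real.exp (-(3 / 4 * π * (saddleParam η).im) - π * u ^ 2) *
          (Real.exp (-(π * (√2 / 2 * u))) * (1 + 1 / (4 * u))) := by
        rw [auxIntegrand_eq_div, norm_div, div_eq_mul_inv, norm_auxNumer_neg_zeta8_mul _ hu]
        gcongr
        exact norm_inv_auxDenom_neg_zeta8_mul_le hu
    _ = u ^ k * (1 + 1 / (4 * u)) * Real.exp w := by
        rw [hw, sub_eq_add_neg _ (π * (√2 / 2 * u)), Real.exp_add]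
        ring
    _ ≤ 2 * (‖η‖ ^ k * Real.exp (k * (u / ‖η‖ - 1))) * Real.exp w := by
        gcongr ?_ * _
        exact rpow_mul_one_add_le hu (one_le_norm_of_one_le_re_mul_im h2) hk_one
    _ = 2 * (‖η‖ ^ k * Real.exp (-(2 * π * (η.re * η.im)))) * Real.exp (lowerExponent η u) := by
        rw [mul_assoc, mul_assoc (‖η‖ ^ k), ← Real.exp_add, mul_assoc 2, mul_assoc (‖η‖ ^ k),
          ← Real.exp_add, hk, hw, lowerExponent, saddleParam_re]
        ring_nf
    _ ≤ _ := by
        gcongr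
        exact rpow_mul_exp_le_norm_auxNumer h0 (saddleParam_im_nonneg h0 h1)

theorem three_fourths_norm_sq_le (h0 : 0 ≤ η.im) (h1 : η.im ≤ η.re)
    (hS : 4 * (η.re * η.im) ≤ ‖η‖ ^ 2) : 3 / 4 * ‖η‖ ^ 2 ≤ η.re ^ 2 - η.im ^ 2 := by
  have hprod : 0 ≤ η.re * η.im := mul_nonneg (h0.trans h1) h0
  have hsq := pow_le_pow_left₀ (by positivity) hS 2
  rw [norm_sq_eq_re_sq_add_im_sq] at hsq ⊢
  refine le_of_sq_le_sq ?_ (sub_nonneg.2 (pow_le_pow_left₀ h0 h1 2))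
  nlinarith

theorem norm_sq_le_saddleParam_im (h0 : 0 ≤ η.im) (h1 : η.im ≤ η.re)
    (hS : 4 * (η.re * η.im) ≤ ‖η‖ ^ 2) : ‖η‖ ^ 2 ≤ (saddleParam η).im := by
  rw [saddleParam_im]
  nlinarith [three_fourths_norm_sq_le h0 h1 hS, Real.pi_gt_three]

theorem im_le_norm_div_sqrt_two (h0 : 0 ≤ η.im) (h1 : η.im ≤ η.re) : η.im ≤ √2 / 2 * ‖η‖ := by
  refine le_of_sq_le_sq ?_ (by positivity)
  rw [mul_pow, div_pow, Real.sq_sqrt zero_le_two, norm_sq_eq_re_sq_add_im_sq]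
  nlinarith

theorem lowerExponent_eq (hη : η ≠ 0) {S : ℝ} (hS : 2 * (η.re * η.im) = S * ‖η‖ ^ 2) (u : ℝ) :
    lowerExponent η u = -(π * S * (u - ‖η‖) ^ 2) - π * (1 - S) * u ^ 2 - π * (√2 / 2 * u) -
      3 / 4 * π * (saddleParam η).im := by
  have hnorm : ‖η‖ ≠ 0 := norm_ne_zero_iff.2 hη
  rw [lowerExponent, mul_assoc 2 π, mul_left_comm 2 π, hS]
  field_simp
  ring

theorem lowerExponent_le_of_norm_sq_le (h0 : 0 < η.im) (h1 : η.im < η.re)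
    (hS : ‖η‖ ^ 2 ≤ 4 * (η.re * η.im)) (u : ℝ) :
    lowerExponent η u ≤
      π / 2 - π * η.im - (saddleParam η).im + -(π / 4) * (u - ‖η‖) ^ 2 := by
  have hpi := Real.pi_gt_three
  have hη := ne_zero_of_im_pos h0
  have hnorm : 0 < ‖η‖ ^ 2 := by positivity
  obtain ⟨S, hS_eq⟩ : ∃ S, 2 * (η.re * η.im) = S * ‖η‖ ^ 2 :=
    ⟨_, (div_mul_cancel₀ _ hnorm.ne').symm⟩
  have hS_half : 1 / 2 ≤ S := le_of_mul_le_mul_right (by linarith) hnorm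
  have hS_one : S ≤ 1 := by
    refine le_of_mul_le_mul_right ?_ hnorm
    rw [← hS_eq, norm_sq_eq_re_sq_add_im_sq]
    linarith [sq_nonneg (η.re - η.im)]
  rw [lowerExponent_eq hη hS_eq]
  have hsaddle : π * (1 / 2) * (u - ‖η‖) ^ 2 ≤ π * S * (u - ‖η‖) ^ 2 := by gcongr
  have hgauss : 0 ≤ π * (1 - S) * u ^ 2 :=
    mul_nonneg (mul_nonneg (by linarith) (by linarith)) (sq_nonneg u)
  have him : π * η.im ≤ π * (√2 / 2 * ‖η‖) := by
    gcongr
    exact im_le_norm_div_sqrt_two h0.le h1.le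
  have hparam : (saddleParam η).im ≤ 3 / 4 * π * (saddleParam η).im := by
    nlinarith [saddleParam_im_nonneg h0 h1]
  have hlinear : √2 / 2 * (‖η‖ - u) ≤ 1 / 4 * (u - ‖η‖) ^ 2 + 1 / 2 := by
    nlinarith [sq_nonneg ((‖η‖ - u) / 2 - √2 / 2), Real.sq_sqrt (zero_le_two (α := ℝ))]
  linarith [mul_le_mul_of_nonneg_left hlinear Real.pi_pos.le]

theorem lowerExponent_le_of_le_norm_sq (h0 : 0 < η.im) (h1 : η.im < η.re) (hη : 1 ≤ ‖η‖)
    (hS : 4 * (η.re * η.im) ≤ ‖η‖ ^ 2) (hu : 0 ≤ u) :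
    lowerExponent η u ≤ π / 2 - π * η.im - (saddleParam η).im + -(π / 4) * u ^ 2 := by
  have hpi := Real.pi_gt_three
  have hnorm : 0 < ‖η‖ ^ 2 := by positivity
  obtain ⟨S, hS_eq⟩ : ∃ S, 2 * (η.re * η.im) = S * ‖η‖ ^ 2 :=
    ⟨_, (div_mul_cancel₀ _ hnorm.ne').symm⟩
  have hS_half : S ≤ 1 / 2 := le_of_mul_le_mul_right (by linarith) hnorm
  have hS_nonneg : 0 ≤ S := by
    refine nonneg_of_mul_nonneg_left ?_ hnorm
    rw [← hS_eq]
    exact mul_nonneg zero_le_two (mul_nonneg (h0.trans h1).le h0.le)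
  rw [lowerExponent_eq (ne_zero_of_im_pos h0) hS_eq]
  have hsaddle : 0 ≤ π * S * (u - ‖η‖) ^ 2 := by positivity
  have hgauss : π * (1 / 4) * u ^ 2 ≤ π * (1 - S) * u ^ 2 := by
    gcongr
    linarith
  have him : π * η.im ≤ π * ‖η‖ ^ 2 := by
    gcongr
    exact (le_abs_self _).trans ((abs_im_le_norm η).trans (le_self_pow₀ hη two_ne_zero))
  have hparam : π * ‖η‖ ^ 2 ≤ (3 / 4 * π - 1) * (saddleParam η).im := by
    have hcone : 2 * π * (3 / 4 * ‖η‖ ^ 2) ≤ (saddleParam η).im := by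
      rw [saddleParam_im]
      gcongr
      exact three_fourths_norm_sq_le h0.le h1.le hS
    calc π * ‖η‖ ^ 2 ≤ 5 / 4 * (2 * π * (3 / 4 * ‖η‖ ^ 2)) := by
          linarith [mul_pos Real.pi_pos hnorm]
      _ ≤ 5 / 4 * (saddleParam η).im := by gcongr
      _ ≤ (3 / 4 * π - 1) * (saddleParam η).im :=
          mul_le_mul_of_nonneg_right (by linarith) (saddleParam_im_nonneg h0 h1)
  have : 0 ≤ π * (√2 / 2 * u) := by positivity
  linarith

theorem norm_lowerPart_le (h0 : 0 < η.im) (h1 : η.im < η.re) (h2 : 1 ≤ η.re * η.im) :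
    ‖lowerPart (saddleParam η)‖ ≤ 40 * ‖auxNumer (saddleParam η) η‖ *
      Real.exp (-(π * η.im)) * Real.exp (-(saddleParam η).im) := by
  obtain ⟨c, hc⟩ : ∃ c : ℝ, ∀ u, 0 < u → lowerExponent η u ≤
      π / 2 - π * η.im - (saddleParam η).im + -(π / 4) * (u - c) ^ 2 := by
    rcases le_total (‖η‖ ^ 2) (4 * (η.re * η.im)) with hS | hS
    · exact ⟨‖η‖, fun u _ => lowerExponent_le_of_norm_sq_le h0 h1 hS u⟩
    · exact ⟨0, fun u hu => by simpa using
        lowerExponent_le_of_le_norm_sq h0 h1 (one_le_norm_of_one_le_re_mul_im h2) hS hu.le⟩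
  have hsqrt : √(π / (π / 4)) = 2 := by
    rw [div_div_cancel₀ Real.pi_ne_zero, show (4 : ℝ) = 2 ^ 2 by norm_num,
      Real.sqrt_sq zero_le_two]
  have hexp : Real.exp (π / 2) ≤ 10 :=
    calc Real.exp (π / 2) ≤ Real.exp (1 + 1) := by
          rw [Real.exp_le_exp]
          linarith [Real.pi_lt_four]
      _ ≤ 3 * 3 := by
          rw [Real.exp_add]
          gcongr <;> exact Real.exp_one_lt_three.le
      _ ≤ 10 := by norm_num
  rw [lowerPart, norm_mul, norm_zeta8, mul_one, ← neg_zero (G := ℝ), ← integral_comp_neg_Ioi]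
  calc _ ≤ 2 * ‖auxNumer (saddleParam η) η‖ *
        Real.exp (π / 2 - π * η.im - (saddleParam η).im) * √(π / (π / 4)) := by
        refine norm_integral_Ioi_gaussian_le (c := c) (by positivity) (by positivity) fun u hu => ?_
        refine (norm_auxIntegrand_neg_zeta8_mul_le h0 h1 h2 hu).trans ?_
        rw [mul_assoc _ (Real.exp _), ← Real.exp_add]
        gcongr
        exact hc u hu
    _ = 4 * Real.exp (π / 2) * (‖auxNumer (saddleParam η) η‖ * Real.exp (-(π * η.im)) *
        Real.exp (-(saddleParam η).im)) := by
        rw [hsqrt, sub_sub, sub_eq_add_neg (π / 2), neg_add, Real.exp_add, Real.exp_add]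
        ring
    _ ≤ 4 * 10 * (‖auxNumer (saddleParam η) η‖ * Real.exp (-(π * η.im)) *
        Real.exp (-(saddleParam η).im)) := by gcongr
    _ = _ := by ring

end LowerPartBound

section RelExponent

variable {η x : ℂ} {m : ℝ}

/-- The logarithm of `auxMode (saddleParam η) m x / auxMode (saddleParam η) m η`. -/
noncomputable def relExponent (η : ℂ) (m : ℝ) (x : ℂ) : ℂ :=
  saddleParam η * (((x / η) ^ 2 - 1) / 2 - (log x - log η)) + (π : ℂ) * I * (m * (x - η))

/-- The second order Taylor polynomial of `relExponent η m` at `η`. -/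
noncomputable def relQuadratic (η : ℂ) (m : ℝ) (x : ℂ) : ℂ :=
  2 * (π : ℂ) * I * (x - η) ^ 2 + (π : ℂ) * I * (m * (x - η))

/-- The contribution of the saddle point to `rayTerm (saddleParam η) m`: the factor after `auxMode`
is the integral of `exp ∘ relQuadratic η m` over a line in the direction of the open first
quadrant. -/
noncomputable def saddleTerm (η : ℂ) (m : ℝ) : ℂ :=
  auxMode (saddleParam η) m η * (zeta8 / √2 * exp (-((π : ℂ) * I * m ^ 2 / 8)))

theorem auxMode_eq_mul_exp_relExponent (hη : η ≠ 0) (hx : x ≠ 0) (m : ℝ) :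
    auxMode (saddleParam η) m x = auxMode (saddleParam η) m η * exp (relExponent η m x) := by
  simp only [auxMode, auxNumer, relExponent, saddleParam, cpow_def_of_ne_zero hη,
    cpow_def_of_ne_zero hx, ← exp_add]
  congr 1
  field_simp
  ring

theorem norm_exp_sub_exp_le (z w : ℂ) :
    ‖exp z - exp w‖ ≤ Real.exp w.re * (‖z - w‖ * Real.exp ‖z - w‖) := by
  have hexp : ‖exp (z - w) - 1‖ ≤ ‖z - w‖ * Real.exp ‖z - w‖ := by
    simpa using norm_exp_sub_sum_le_norm_mul_exp (z - w) 1
  calc ‖exp z - exp w‖ = Real.exp w.re * ‖exp (z - w) - 1‖ := by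
        rw [← norm_exp, ← norm_mul, mul_sub, ← exp_add, add_sub_cancel, mul_one]
    _ ≤ _ := by gcongr

theorem norm_log_one_add_sub_sq_le {w : ℂ} (hw : ‖w‖ ≤ 1 / 4) :
    ‖log (1 + w) - (w - w ^ 2 / 2)‖ ≤ ‖w‖ ^ 3 / 2 := by
  have htaylor : logTaylor 3 w = w - w ^ 2 / 2 := by
    simp [logTaylor_succ, logTaylor_zero]
    ring
  have hinv : (1 - ‖w‖)⁻¹ ≤ 3 / 2 := inv_le_of_inv_le₀ (by norm_num) (by linarith)
  calc ‖log (1 + w) - (w - w ^ 2 / 2)‖ ≤ ‖w‖ ^ 3 * (1 - ‖w‖)⁻¹ / 3 := by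
        rw [← htaylor]
        exact_mod_cast norm_log_sub_logTaylor_le 2 (by linarith)
    _ ≤ ‖w‖ ^ 3 * (3 / 2) / 3 := by gcongr
    _ = ‖w‖ ^ 3 / 2 := by ring

theorem log_mul_one_add {w : ℂ} (hη : 0 < η.re) (hw : ‖w‖ < 1) :
    log (η * (1 + w)) = log η + log (1 + w) := by
  have hre : 0 < (1 + w).re := by
    simp only [add_re, one_re]
    linarith [neg_abs_le w.re, abs_re_le_norm w]
  have hargη := abs_lt.1 (abs_arg_lt_pi_div_two_iff.2 (Or.inl hη))
  have hargw := abs_lt.1 (abs_arg_lt_pi_div_two_iff.2 (Or.inl hre))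
  exact log_mul (ne_zero_of_re_pos hη) (ne_zero_of_re_pos hre) ⟨by linarith, by linarith⟩

theorem norm_relExponent_sub_relQuadratic_le (hη : 0 < η.re) (hx : ‖x - η‖ ≤ ‖η‖ / 4) (m : ℝ) :
    ‖relExponent η m x - relQuadratic η m x‖ ≤ π * ‖x - η‖ ^ 3 / ‖η‖ := by
  have hη0 := ne_zero_of_re_pos hη
  have hnorm : 0 < ‖η‖ := norm_pos_iff.2 hη0
  obtain ⟨w, rfl⟩ : ∃ w, x = η * (1 + w) := ⟨x / η - 1, by field_simp; ring⟩
  rw [show η * (1 + w) - η = η * w by ring, norm_mul] at hx ⊢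
  have hw : ‖w‖ ≤ 1 / 4 := le_of_mul_le_mul_left (by linarith) hnorm
  have hdiff : relExponent η m (η * (1 + w)) - relQuadratic η m (η * (1 + w)) =
      -saddleParam η * (log (1 + w) - (w - w ^ 2 / 2)) := by
    rw [relExponent, relQuadratic, log_mul_one_add hη (by linarith), mul_div_cancel_left₀ _ hη0,
      saddleParam]
    ring
  have hparam : ‖saddleParam η‖ = 2 * π * ‖η‖ ^ 2 := by
    simp [saddleParam, abs_of_pos Real.pi_pos]
  rw [hdiff, norm_mul, norm_neg, hparam]
  calc 2 * π * ‖η‖ ^ 2 * ‖log (1 + w) - (w - w ^ 2 / 2)‖ ≤ 2 * π * ‖η‖ ^ 2 * (‖w‖ ^ 3 / 2) := by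
        gcongr
        exact norm_log_one_add_sub_sq_le hw
    _ = π * (‖η‖ * ‖w‖) ^ 3 / ‖η‖ := by field_simp

end RelExponent

section QuadraticIntegral

variable {d : ℂ}

theorem relQuadratic_add_mul_ofReal (η : ℂ) (m : ℝ) (c d : ℂ) (u : ℝ) :
    relQuadratic η m (c + d * u) = 2 * (π : ℂ) * I * d ^ 2 * u ^ 2 +
      (π : ℂ) * I * d * (4 * (c - η) + m) * u + relQuadratic η m c := by
  rw [relQuadratic, relQuadratic]
  ring

theorem two_pi_I_mul_sq_re_neg (h0 : 0 < d.im) (h1 : 0 < d.re) :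
    (2 * (π : ℂ) * I * d ^ 2).re < 0 := by
  have := saddleParam_re d
  rw [saddleParam] at this
  rw [this]
  have : 0 < d.re * d.im := mul_pos h1 h0
  exact neg_neg_of_pos (by positivity)

theorem integrable_exp_relQuadratic (h0 : 0 < d.im) (h1 : 0 < d.re) (η : ℂ) (m : ℝ) (c : ℂ) :
    Integrable fun u : ℝ => exp (relQuadratic η m (c + d * u)) := by
  simp only [relQuadratic_add_mul_ofReal]
  exact integrable_cexp_quadratic' (two_pi_I_mul_sq_re_neg h0 h1) _ _

theorem integral_exp_relQuadratic (h0 : 0 < d.im) (h1 : 0 < d.re) (η : ℂ) (m : ℝ) (c : ℂ) :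
    (∫ u : ℝ, exp (relQuadratic η m (c + d * u))) * d =
      zeta8 / √2 * exp (-((π : ℂ) * I * m ^ 2 / 8)) := by
  have hd := ne_zero_of_im_pos h0
  have hsqrt : ((√2 : ℝ) : ℂ) ^ 2 = 2 := by
    rw [← ofReal_pow, Real.sq_sqrt zero_le_two]
    norm_num
  have hroot : (π : ℂ) / -(2 * (π : ℂ) * I * d ^ 2) = (zeta8 / (√2 * d)) ^ 2 := by
    rw [div_pow, mul_pow, hsqrt, zeta8_sq]
    field_simp
    rw [I_sq]
  have hre : 0 < (zeta8 / (√2 * d)).re := by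
    have hnormSq : 0 < normSq d := normSq_pos.2 hd
    have hzeta : zeta8 / (√2 : ℝ) = 1 / 2 + 1 / 2 * I := by
      rw [zeta8_eq]
      field_simp
      push_cast
      field_simp
    rw [← div_div, hzeta, div_re]
    simp only [one_div, add_re, inv_re, re_ofNat, normSq_ofNat, div_self_mul_self', mul_re, I_re,
      mul_zero, inv_im, im_ofNat, neg_zero, zero_div, I_im, mul_one, sub_self, add_zero, add_im,
      mul_im, zero_add]
    positivity
  have hexponent : relQuadratic η m c - ((π : ℂ) * I * d * (4 * (c - η) + m)) ^ 2 /
      (4 * (2 * (π : ℂ) * I * d ^ 2)) = -((π : ℂ) * I * m ^ 2 / 8) := by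
    rw [relQuadratic]
    field_simp
    ring
  simp only [relQuadratic_add_mul_ofReal]
  rw [integral_cexp_quadratic (two_pi_I_mul_sq_re_neg h0 h1), hroot, one_div,
    sq_cpow_two_inv hre, hexponent]
  field_simp

end QuadraticIntegral

section Comparison

variable {E : Type*} [NormedAddCommGroup E] {f g : ℝ → E} {A b c : ℝ}

theorem integrable_of_norm_sub_le_gaussian (hb : 0 < b) (hf : AEStronglyMeasurable f)
    (hg : Integrable g) (hfg : ∀ u, ‖f u - g u‖ ≤ A * Real.exp (-b * (u - c) ^ 2)) :
    Integrable f := by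
  have hsub : Integrable (f - g) :=
    ((integrable_exp_neg_mul_sub_sq hb c).const_mul A).mono' (hf.sub hg.aestronglyMeasurable)
      (Eventually.of_forall hfg)
  simpa using hsub.add hg

theorem norm_integral_sub_integral_le [NormedSpace ℝ E] (hb : 0 < b) (hf : AEStronglyMeasurable f)
    (hg : Integrable g) (hfg : ∀ u, ‖f u - g u‖ ≤ A * Real.exp (-b * (u - c) ^ 2)) :
    ‖(∫ u, f u) - ∫ u, g u‖ ≤ A * √(π / b) := by
  rw [← integral_sub (integrable_of_norm_sub_le_gaussian hb hf hg hfg) hg,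
    ← integral_exp_neg_mul_sub_sq b c, ← integral_const_mul]
  exact norm_integral_le_of_norm_le ((integrable_exp_neg_mul_sub_sq hb c).const_mul A)
    (Eventually.of_forall hfg)

theorem norm_integral_Ioi_sub_integral_le [NormedSpace ℝ E] (hb : 0 < b)
    (hf : AEStronglyMeasurable f) (hg : Integrable g)
    (hfg : ∀ u, 0 < u → ‖f u - g u‖ ≤ A * Real.exp (-b * (u - c) ^ 2))
    (hg' : ∀ u ≤ 0, ‖g u‖ ≤ A * Real.exp (-b * (u - c) ^ 2)) :
    ‖(∫ u in Ioi (0 : ℝ), f u) - ∫ u, g u‖ ≤ A * √(π / b) := by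
  rw [← integral_indicator measurableSet_Ioi]
  refine norm_integral_sub_integral_le (c := c) hb (hf.indicator measurableSet_Ioi) hg fun u => ?_
  rcases lt_or_ge 0 u with hu | hu
  · simpa [hu] using hfg u hu
  · simpa [hu.not_gt] using hg' u hu

theorem exp_le_div_mul_exp {r u t a b d : ℝ} (hr : 0 < r) (hu : r ≤ 8 * |u|) (hd : 0 < d)
    (ht : t ≤ b * |u| - (a + d) * u ^ 2) :
    Real.exp t ≤ 8 * Real.exp ((b + 1) ^ 2 / (4 * d)) / r * Real.exp (-a * u ^ 2) := by
  have hone : 1 ≤ 8 / r * Real.exp |u| := by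
    rw [div_mul_eq_mul_div, one_le_div₀ hr]
    linarith [Real.add_one_le_exp |u|]
  calc Real.exp t ≤ Real.exp ((b + 1) ^ 2 / (4 * d) - |u| + -a * u ^ 2) := by
        rw [Real.exp_le_exp]
        linarith [mul_abs_sub_mul_sq_le b hd u]
    _ ≤ Real.exp ((b + 1) ^ 2 / (4 * d) - |u| + -a * u ^ 2) * (8 / r * Real.exp |u|) :=
        le_mul_of_one_le_right (Real.exp_pos _).le hone
    _ = _ := by
        rw [Real.exp_add, Real.exp_sub]
        field_simp

end Comparison

section Ray

variable {η : ℂ}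

theorem cube_le_exp {z : ℝ} (hz : 0 ≤ z) : z ^ 3 ≤ 6 * Real.exp z := by
  have := Real.pow_div_factorial_le_exp z hz 3
  norm_num [Nat.factorial] at this
  linarith

theorem relExponent_mul_ofReal_re (hη : η ≠ 0) (m : ℝ) {u : ℝ} (hu : 0 < u) :
    (relExponent η m (η * u)).re =
      (saddleParam η).re * ((u ^ 2 - 1) / 2 - Real.log u) - π * (m * (η.im * (u - 1))) := by
  have hform : relExponent η m (η * u) =
      ((((u ^ 2 - 1) / 2 - Real.log u : ℝ)) : ℂ) * saddleParam η +
        ((π * (m * (u - 1)) : ℝ) : ℂ) * (I * η) := by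
    rw [relExponent, log_mul_ofReal u hu η hη, mul_div_cancel_left₀ _ hη]
    push_cast
    ring
  rw [hform, add_re, re_ofReal_mul, re_ofReal_mul, I_mul_re]
  ring

theorem relQuadratic_mul_ofReal_re (η : ℂ) (m u : ℝ) : (relQuadratic η m (η * u)).re =
    (saddleParam η).re * (u - 1) ^ 2 - π * (m * (η.im * (u - 1))) := by
  have hform : relQuadratic η m (η * u) =
      (((u - 1) ^ 2 : ℝ) : ℂ) * saddleParam η + ((π * (m * (u - 1)) : ℝ) : ℂ) * (I * η) := by
    rw [relQuadratic, saddleParam]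
    push_cast
    ring
  rw [hform, add_re, re_ofReal_mul, re_ofReal_mul, I_mul_re]
  ring

theorem saddleParam_re_mul_sub_le (hS : ‖η‖ ^ 2 ≤ 4 * (η.re * η.im))
    {c w r : ℝ} (hc : 0 ≤ c) (hr : c * w ^ 2 ≤ r) :
    (saddleParam η).re * r - π * (η.im * w) ≤ π * |‖η‖ * w| - c * π * (‖η‖ * w) ^ 2 := by
  have hlinear : -(η.im * w) ≤ |‖η‖ * w| := by
    rw [abs_mul, abs_norm]
    calc -(η.im * w) ≤ |η.im| * |w| := by rw [← abs_mul]; exact neg_le_abs _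
      _ ≤ ‖η‖ * |w| := by gcongr; exact abs_im_le_norm η
  have hquadratic : c * w ^ 2 * ‖η‖ ^ 2 ≤ r * (4 * (η.re * η.im)) := by
    have : 0 ≤ r := hr.trans' (by positivity)
    gcongr
  rw [saddleParam_re]
  linarith [mul_le_mul_of_nonneg_left hlinear Real.pi_pos.le,
    mul_le_mul_of_nonneg_left hquadratic Real.pi_pos.le]

theorem relQuadratic_mul_ofReal_re_le (hS : ‖η‖ ^ 2 ≤ 4 * (η.re * η.im)) (u : ℝ) :
    (relQuadratic η 1 (η * u)).re ≤ π * |‖η‖ * (u - 1)| - π * (‖η‖ * (u - 1)) ^ 2 := by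
  rw [relQuadratic_mul_ofReal_re, one_mul]
  linarith [saddleParam_re_mul_sub_le hS zero_le_one (one_mul ((u - 1) ^ 2)).le]

theorem relExponent_mul_ofReal_re_le (hη : η ≠ 0) (hS : ‖η‖ ^ 2 ≤ 4 * (η.re * η.im)) {u : ℝ}
    (hu : 0 < u) :
    (relExponent η 1 (η * u)).re ≤ π * |‖η‖ * (u - 1)| - π / 2 * (‖η‖ * (u - 1)) ^ 2 := by
  have hlog : 1 / 2 * (u - 1) ^ 2 ≤ (u ^ 2 - 1) / 2 - Real.log u := by
    linarith [Real.log_le_sub_one_of_pos hu]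
  rw [relExponent_mul_ofReal_re hη 1 hu, one_mul]
  linarith [saddleParam_re_mul_sub_le hS one_half_pos.le hlog]

theorem norm_exp_le_of_re_le_of_far (hη : η ≠ 0) {w : ℝ} (hw : 1 / 8 ≤ |w|) {z : ℂ}
    (hz : z.re ≤ π * |‖η‖ * w| - π / 2 * (‖η‖ * w) ^ 2) :
    ‖exp z‖ ≤ 8 * Real.exp 5 / ‖η‖ * Real.exp (-(1 / 2) * (‖η‖ * w) ^ 2) := by
  have hnorm : 0 < ‖η‖ := norm_pos_iff.2 hη
  have hpi := Real.pi_gt_three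
  have hpi' := Real.pi_lt_d2
  have hfar : ‖η‖ ≤ 8 * |‖η‖ * w| := by
    rw [abs_mul, abs_norm]
    linarith [mul_le_mul_of_nonneg_left hw hnorm.le]
  have hconst : (π + 1) ^ 2 / (4 * (π / 2 - 1 / 2)) ≤ 5 := by
    rw [div_le_iff₀ (by linarith)]
    nlinarith
  rw [norm_exp]
  calc _ ≤ 8 * Real.exp ((π + 1) ^ 2 / (4 * (π / 2 - 1 / 2))) / ‖η‖ *
        Real.exp (-(1 / 2) * (‖η‖ * w) ^ 2) :=
        exp_le_div_mul_exp hnorm hfar (by linarith) (by linarith)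
    _ ≤ _ := by gcongr

theorem norm_exp_relExponent_sub_le_of_near (hη : 0 < η.re) (hS : ‖η‖ ^ 2 ≤ 4 * (η.re * η.im))
    {u : ℝ} (hu : |u - 1| ≤ 1 / 8) :
    ‖exp (relExponent η 1 (η * u)) - exp (relQuadratic η 1 (η * u))‖ ≤
      20 * Real.exp 5 / ‖η‖ * Real.exp (-(1 / 2) * (‖η‖ * (u - 1)) ^ 2) := by
  have hnorm : 0 < ‖η‖ := norm_pos_iff.2 (ne_zero_of_re_pos hη)
  have hpi := Real.pi_gt_three
  have hpi' := Real.pi_lt_d2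
  have hdist : ‖η * u - η‖ = |‖η‖ * (u - 1)| := by
    rw [show η * u - η = η * ((u - 1 : ℝ) : ℂ) by push_cast; ring, norm_mul, norm_real,
      Real.norm_eq_abs, abs_mul, abs_norm]
  have hz : |‖η‖ * (u - 1)| ≤ ‖η‖ / 8 := by
    rw [abs_mul, abs_norm]
    linarith [mul_le_mul_of_nonneg_left hu hnorm.le]
  have hdiff := norm_relExponent_sub_relQuadratic_le hη (x := η * u) (by linarith) 1
  have hre := relQuadratic_mul_ofReal_re_le hS u
  rw [hdist] at hdiff
  set z := ‖η‖ * (u - 1)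
  have hsmall : π * |z| ^ 3 / ‖η‖ ≤ π / 8 * z ^ 2 := by
    rw [div_le_iff₀ hnorm, ← sq_abs z]
    nlinarith [mul_le_mul_of_nonneg_left hz (by positivity : 0 ≤ π * |z| ^ 2)]
  have hexponent : π * |z| - π * z ^ 2 + (|z| + π / 8 * z ^ 2) ≤ 5 + -(1 / 2) * z ^ 2 := by
    rw [← sq_abs z]
    nlinarith [sq_nonneg (|z| - 1.2), abs_nonneg z, sq_nonneg |z|]
  calc _ ≤ _ := norm_exp_sub_exp_le _ _
    _ ≤ Real.exp (π * |z| - π * z ^ 2) *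
        (3.15 * (6 * Real.exp |z|) / ‖η‖ * Real.exp (π / 8 * z ^ 2)) := by
        gcongr
        · calc _ ≤ π * |z| ^ 3 / ‖η‖ := hdiff
            _ ≤ _ := by
              gcongr
              exact cube_le_exp (abs_nonneg z)
        · exact hdiff.trans hsmall
    _ = 18.9 / ‖η‖ * Real.exp (π * |z| - π * z ^ 2 + (|z| + π / 8 * z ^ 2)) := by
        rw [Real.exp_add, Real.exp_add]
        ring
    _ ≤ 20 / ‖η‖ * Real.exp (5 + -(1 / 2) * z ^ 2) := by
        gcongr
        norm_num
    _ = _ := by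
        rw [Real.exp_add]
        ring

theorem norm_exp_relExponent_sub_mul_ofReal_le (hη : 0 < η.re)
    (hS : ‖η‖ ^ 2 ≤ 4 * (η.re * η.im)) {u : ℝ} (hu : 0 < u) :
    ‖exp (relExponent η 1 (η * u)) - exp (relQuadratic η 1 (η * u))‖ ≤
      20 * Real.exp 5 / ‖η‖ * Real.exp (-(‖η‖ ^ 2 / 2) * (u - 1) ^ 2) := by
  have hη0 := ne_zero_of_re_pos hη
  have hsq : -(‖η‖ ^ 2 / 2) * (u - 1) ^ 2 = -(1 / 2) * (‖η‖ * (u - 1)) ^ 2 := by ring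
  rw [hsq]
  rcases le_total |u - 1| (1 / 8) with hnear | hfar
  · exact norm_exp_relExponent_sub_le_of_near hη hS hnear
  · have hexact := norm_exp_le_of_re_le_of_far hη0 hfar (relExponent_mul_ofReal_re_le hη0 hS hu)
    have hquadratic := norm_exp_le_of_re_le_of_far hη0 hfar
      ((relQuadratic_mul_ofReal_re_le hS u).trans (by
        linarith [mul_nonneg Real.pi_pos.le (sq_nonneg (‖η‖ * (u - 1)))]))
    calc _ ≤ _ := norm_sub_le _ _
      _ ≤ _ := add_le_add hexact hquadratic
      _ = 16 * Real.exp 5 / ‖η‖ * Real.exp (-(1 / 2) * (‖η‖ * (u - 1)) ^ 2) := by ring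
      _ ≤ _ := by
        gcongr
        norm_num

theorem norm_exp_relQuadratic_mul_ofReal_le (hη : η ≠ 0) (hS : ‖η‖ ^ 2 ≤ 4 * (η.re * η.im))
    {u : ℝ} (hu : u ≤ 0) :
    ‖exp (relQuadratic η 1 (η * u))‖ ≤
      20 * Real.exp 5 / ‖η‖ * Real.exp (-(‖η‖ ^ 2 / 2) * (u - 1) ^ 2) := by
  have hsq : -(‖η‖ ^ 2 / 2) * (u - 1) ^ 2 = -(1 / 2) * (‖η‖ * (u - 1)) ^ 2 := by ring
  have hfar : 1 / 8 ≤ |u - 1| := by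
    rw [abs_of_neg (by linarith)]
    linarith
  rw [hsq]
  calc _ ≤ 8 * Real.exp 5 / ‖η‖ * Real.exp (-(1 / 2) * (‖η‖ * (u - 1)) ^ 2) :=
        norm_exp_le_of_re_le_of_far hη hfar ((relQuadratic_mul_ofReal_re_le hS u).trans (by
          linarith [mul_nonneg Real.pi_pos.le (sq_nonneg (‖η‖ * (u - 1)))]))
    _ ≤ _ := by
      gcongr
      norm_num

theorem rayTerm_eq_mul_integral (h0 : 0 < η.im) (h1 : η.im < η.re) {m : ℝ} (hm : 0 ≤ m) :
    rayTerm (saddleParam η) m = auxMode (saddleParam η) m η *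
      ((∫ u in Ioi (0 : ℝ), exp (relExponent η m (η * u))) * η) := by
  have hη := ne_zero_of_im_pos h0
  have hparam : (saddleParam η).re ≤ 0 := by
    rw [saddleParam_re]
    have : 0 < η.re * η.im := mul_pos (h0.trans h1) h0
    exact neg_nonpos.2 (by positivity)
  rw [rayTerm_eq_rotate h0 h1 (saddleParam_im_nonneg h0 h1) hparam hm, ← mul_assoc,
    ← integral_const_mul]
  congr 1
  refine setIntegral_congr_fun measurableSet_Ioi fun u (hu : 0 < u) => ?_
  exact auxMode_eq_mul_exp_relExponent hη (mul_ne_zero hη (ofReal_ne_zero.2 hu.ne')) m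

theorem norm_rayTerm_sub_saddleTerm_le (h0 : 0 < η.im) (h1 : η.im < η.re)
    (hS : ‖η‖ ^ 2 ≤ 4 * (η.re * η.im)) :
    ‖rayTerm (saddleParam η) 1 - saddleTerm η 1‖ ≤
      ‖auxMode (saddleParam η) 1 η‖ * (60 * Real.exp 5 / ‖η‖) := by
  have hre : 0 < η.re := h0.trans h1
  have hη := ne_zero_of_im_pos h0
  have hmeas : AEStronglyMeasurable fun u : ℝ => exp (relExponent η 1 (η * u)) := by
    unfold relExponent
    fun_prop
  have hquadratic : Integrable fun u : ℝ => exp (relQuadratic η 1 (η * u)) := by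
    simpa only [zero_add] using integrable_exp_relQuadratic h0 hre η 1 0
  have hgauss : (∫ u : ℝ, exp (relQuadratic η 1 (η * u))) * η =
      zeta8 / √2 * exp (-((π : ℂ) * I * (1 : ℝ) ^ 2 / 8)) := by
    simpa only [zero_add] using integral_exp_relQuadratic h0 hre η 1 0
  have hsqrt : √(π / (‖η‖ ^ 2 / 2)) ≤ 3 / ‖η‖ := by
    rw [Real.sqrt_le_left (by positivity), div_pow, div_div_eq_mul_div]
    gcongr
    linarith [Real.pi_lt_d2]
  have hdiff := norm_integral_Ioi_sub_integral_le (c := 1) (by positivity) hmeas hquadratic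
    (fun u hu => norm_exp_relExponent_sub_mul_ofReal_le hre hS hu)
    (fun u hu => norm_exp_relQuadratic_mul_ofReal_le hη hS hu)
  rw [rayTerm_eq_mul_integral h0 h1 zero_le_one, saddleTerm, ← hgauss, ← mul_sub, ← sub_mul,
    norm_mul, norm_mul]
  gcongr
  calc _ ≤ 20 * Real.exp 5 / ‖η‖ * (3 / ‖η‖) * ‖η‖ := by
        gcongr
        exact hdiff.trans (by gcongr)
    _ = _ := by
        field_simp
        ring

end Ray

section RotatedCoordinates

variable {b : ℝ}

theorem concaveOn_arctan : ConcaveOn ℝ (Ici 0) Real.arctan := by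
  refine AntitoneOn.concaveOn_of_deriv (convex_Ici 0) Real.continuous_arctan.continuousOn
    Real.differentiable_arctan.differentiableOn fun p hp q _ hpq => ?_
  have hp0 : 0 ≤ p := interior_subset hp
  simp only [Real.deriv_arctan]
  gcongr

theorem arctan_sub_arctan_le {p q : ℝ} (hp : 0 ≤ p) (hq : 0 ≤ q) :
    Real.arctan p - Real.arctan q ≤ (p - q) / (1 + q ^ 2) := by
  have hderiv := Real.hasDerivAt_arctan q
  rw [div_eq_mul_one_div]
  rcases lt_trichotomy p q with h | rfl | h
  · have hslope := concaveOn_arctan.le_slope_of_hasDerivAt hp hq h hderiv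
    rw [slope_def_field, le_div_iff₀ (sub_pos.2 h)] at hslope
    linarith
  · simp
  · have hslope := concaveOn_arctan.slope_le_of_hasDerivAt hq hp h hderiv
    rw [slope_def_field, div_le_iff₀ (sub_pos.2 h)] at hslope
    linarith

theorem eq_zeta8_mul (x : ℂ) : x =
    zeta8 * ((√2 / 2 * (x.re + x.im) : ℝ) - (√2 / 2 * (x.re - x.im) : ℝ) * I) := by
  have hsqrt : (√2 : ℝ) ^ 2 = 2 := Real.sq_sqrt zero_le_two
  apply Complex.ext
  · simp only [zeta8_mul_re, sub_re, sub_im, ofReal_re, ofReal_im, re_ofReal_mul, im_ofReal_mul,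
      I_re, I_im]
    linear_combination (-(x.re / 2)) * hsqrt
  · simp only [zeta8_mul_im, sub_re, sub_im, ofReal_re, ofReal_im, re_ofReal_mul, im_ofReal_mul,
      I_re, I_im]
    linear_combination (-(x.im / 2)) * hsqrt

theorem zeta8_mul_sub_mul_I_re (a b : ℝ) : (zeta8 * (a - b * I)).re = √2 / 2 * (a + b) := by
  rw [zeta8_mul_re]
  simp

theorem zeta8_mul_sub_mul_I_im (a b : ℝ) : (zeta8 * (a - b * I)).im = √2 / 2 * (a - b) := by
  rw [zeta8_mul_im]
  simp [sub_eq_add_neg]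

theorem norm_zeta8_mul_sub_mul_I_sq (a b : ℝ) : ‖zeta8 * (a - b * I)‖ ^ 2 = a ^ 2 + b ^ 2 := by
  rw [norm_mul, norm_zeta8, one_mul, norm_sq_eq_re_sq_add_im_sq]
  simp

theorem arg_zeta8_mul_sub_mul_I (a : ℝ) (hb : 0 < b) :
    arg (zeta8 * (a - b * I)) = -(π / 4) + Real.arctan (a / b) := by
  have hpi := Real.pi_pos
  have hargz : arg (exp ((-(π / 4) : ℝ) * I)) = -(π / 4) := by
    rw [exp_mul_I, arg_cos_add_sin_mul_I ⟨by linarith, by linarith⟩]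
  have hre : 0 < (b + a * I : ℂ).re := by simpa
  have hargw : arg (b + a * I : ℂ) = Real.arctan (a / b) := by
    rw [arg_eq_arctan hre]
    simp
  have hrot : zeta8 * (a - b * I) = exp ((-(π / 4) : ℝ) * I) * (b + a * I) := by
    rw [zeta8, show ((π / 4 : ℝ) : ℂ) * I = (-(π / 4) : ℝ) * I + π / 2 * I by push_cast; ring,
      exp_add, exp_pi_div_two_mul_I]
    linear_combination -(b : ℂ) * exp ((-(π / 4) : ℝ) * I) * I_sq
  rw [hrot, (arg_mul_eq_add_arg_iff (exp_ne_zero _) (ne_zero_of_re_pos hre)).2, hargz, hargw]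
  rw [hargz, hargw]
  exact ⟨by linarith [Real.neg_pi_div_two_lt_arctan (a / b)],
    by linarith [Real.arctan_lt_pi_div_two (a / b)]⟩

end RotatedCoordinates

section FarExponent

variable {η : ℂ} {α β a b κ u : ℝ}

/-- An upper bound, up to the factor `π`, for the real part of
`saddleParam η * (((x / η) ^ 2 - 1) / 2 - (log x - log η))` at `x = zeta8 * (a - b * I)` and
`η = zeta8 * (α - β * I)`. It comes from `2 * log ‖x / η‖ ≤ ‖x / η‖ ^ 2 - 1`, the arguments being
kept exact. -/
noncomputable def rotatedExponent (α β a b : ℝ) : ℝ :=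
  2 / (α ^ 2 + β ^ 2) * (α ^ 2 * b ^ 2 - β ^ 2 * a ^ 2) +
    4 * (α * β) * (Real.arctan (a / b) - Real.arctan (α / β))

theorem rotatedExponent_le_of_nonpos (hβ : 0 < β) (hαβ : β ≤ α)
    (hprod : 3 / 8 * (α ^ 2 + β ^ 2) ≤ α * β) (hnorm : α ^ 2 + β ^ 2 ≤ 4 * β ^ 2)
    (hb : 0 < b) (hbβ : b ≤ β) (ha : a ≤ 0) :
    rotatedExponent α β a b ≤ -(3 / 4 * (α ^ 2 + β ^ 2)) - a ^ 2 / 2 := by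
  have hα : 0 < α := hβ.trans_le hαβ
  have harctan_nonpos : Real.arctan (a / b) ≤ 0 :=
    Real.arctan_zero ▸ Real.arctan_mono (div_nonpos_of_nonpos_of_nonneg ha hb.le)
  have harctan_ge : π / 4 ≤ Real.arctan (α / β) :=
    Real.arctan_one ▸ Real.arctan_mono ((one_le_div₀ hβ).2 hαβ)
  have hangle : 4 * (α * β) * (Real.arctan (a / b) - Real.arctan (α / β)) ≤
      4 * (α * β) * -(3 / 4) := by
    gcongr
    linarith [Real.pi_gt_three]
  have hradial : 2 / (α ^ 2 + β ^ 2) * (α ^ 2 * b ^ 2 - β ^ 2 * a ^ 2) ≤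
      α * β - a ^ 2 / 2 := by
    have hbsq : α ^ 2 * b ^ 2 ≤ α ^ 2 * β ^ 2 := by gcongr
    have hamgm : α * β * (2 * (α * β)) ≤ α * β * (α ^ 2 + β ^ 2) := by
      gcongr
      linarith [two_mul_le_add_sq α β]
    rw [div_mul_eq_mul_div, div_le_iff₀ (by positivity)]
    linarith [mul_le_mul_of_nonneg_right hnorm (by positivity : 0 ≤ a ^ 2 / 2)]
  rw [rotatedExponent]
  linarith

theorem rotatedExponent_le_of_nonneg (hβ : 0 < β) (hα : 0 < α)
    (hnorm : α ^ 2 + β ^ 2 ≤ 4 * β ^ 2) (hbβ : b ≤ β) (hβb : β ≤ 2 * b) (ha : 0 ≤ a) :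
    rotatedExponent α β a b ≤ 4 * a * (β - b) - (a - α) ^ 2 / 2 := by
  have hb : 0 < b := by linarith
  have hr : 0 < α ^ 2 + β ^ 2 := by positivity
  have hangle : Real.arctan (a / b) - Real.arctan (α / β) ≤
      (a / b - α / β) / (1 + (α / β) ^ 2) :=
    arctan_sub_arctan_le (div_nonneg ha hb.le) (div_nonneg hα.le hβ.le)
  have hbsq : b ^ 2 ≤ β ^ 2 := by gcongr
  have hcompleteSquare : 2 / (α ^ 2 + β ^ 2) * (α ^ 2 * β ^ 2 - β ^ 2 * a ^ 2) +
      4 * (α * β) * ((a / b - α / β) / (1 + (α / β) ^ 2)) =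
      4 * (α * β) / (α ^ 2 + β ^ 2) * (β / b * a * (β - b)) -
        2 * β ^ 2 / (α ^ 2 + β ^ 2) * (a - α) ^ 2 := by
    have hdenom : 1 + (α / β) ^ 2 = (α ^ 2 + β ^ 2) / β ^ 2 := by field_simp; ring
    rw [hdenom]
    field_simp
    ring
  have herror : 4 * (α * β) / (α ^ 2 + β ^ 2) * (β / b * a * (β - b)) ≤ 2 * (2 * a * (β - b)) := by
    have hweight : 4 * (α * β) / (α ^ 2 + β ^ 2) ≤ 2 := by
      rw [div_le_iff₀ hr]
      linarith [two_mul_le_add_sq α β]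
    have hratio : β / b ≤ 2 := by rwa [div_le_iff₀ hb]
    have : 0 ≤ β - b := by linarith
    gcongr
  have hsquare : 1 / 2 * (a - α) ^ 2 ≤ 2 * β ^ 2 / (α ^ 2 + β ^ 2) * (a - α) ^ 2 := by
    refine mul_le_mul_of_nonneg_right ?_ (sq_nonneg _)
    rw [le_div_iff₀ hr]
    linarith
  calc rotatedExponent α β a b ≤ 2 / (α ^ 2 + β ^ 2) * (α ^ 2 * β ^ 2 - β ^ 2 * a ^ 2) +
        4 * (α * β) * ((a / b - α / β) / (1 + (α / β) ^ 2)) := by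
        rw [rotatedExponent]
        gcongr
    _ ≤ _ := by linarith

theorem rotatedExponent_sub_le_of_far (hκ : 0 ≤ κ) (hβ : 2 * κ ≤ β) (hβ0 : 0 < β) (hαβ : β ≤ α)
    (hprod : 3 / 8 * (α ^ 2 + β ^ 2) ≤ α * β) (hnorm : α ^ 2 + β ^ 2 ≤ 4 * β ^ 2)
    (hκu : 300 * κ ≤ |u|) (hfar : α ^ 2 + β ^ 2 ≤ 64 * u ^ 2) :
    rotatedExponent α β (α - κ + u) (β - κ) - 4 * κ * u ≤ -(u ^ 2 / 5) := by
  have hα : 0 < α := hβ0.trans_le hαβ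
  have habs : κ * |u| ≤ u ^ 2 / 300 := by
    rw [← sq_abs u]
    nlinarith [abs_nonneg u]
  have hκu' : κ * u ≤ κ * |u| := by gcongr; exact le_abs_self u
  have hκu'' : -(κ * |u|) ≤ κ * u := by
    rw [← mul_neg]
    gcongr
    exact neg_abs_le u
  rcases le_total (α - κ + u) 0 with ha | ha
  · have hsq : u ^ 2 ≤ 2 * (α - κ + u) ^ 2 + 2 * α ^ 2 := by
      nlinarith [sq_nonneg (2 * (α - κ) + u), mul_nonneg hκ hα.le]
    linarith [rotatedExponent_le_of_nonpos hβ0 hαβ hprod hnorm (b := β - κ) (by linarith)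
      (by linarith) ha,
      sq_nonneg α, sq_nonneg β, sq_nonneg u]
  · have hα8 : α ≤ 8 * |u| := by
      refine le_of_sq_le_sq ?_ (by positivity)
      rw [mul_pow, sq_abs]
      nlinarith
    have hcross : (α - κ + u) * κ ≤ 9 * |u| * κ := by
      gcongr
      linarith [le_abs_self u]
    have := rotatedExponent_le_of_nonneg hβ0 hα hnorm (b := β - κ) (by linarith) (by linarith) ha
    linarith [sq_nonneg κ]

theorem relExponent_re (hη : η ≠ 0) (m : ℝ) (x : ℂ) : (relExponent η m x).re =
    4 * π * (η.re * η.im) * (Real.log ‖x‖ - Real.log ‖η‖) +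
    2 * π * (η.re ^ 2 - η.im ^ 2) * (arg x - arg η) -
    2 * π * (x.re * x.im - η.re * η.im) - π * m * (x.im - η.im) := by
  have hform : relExponent η m x = -(saddleParam η * (log x - log η)) +
      (π : ℝ) * (I * (x ^ 2 - η ^ 2)) + ((π * m : ℝ) : ℂ) * (I * (x - η)) := by
    rw [relExponent, saddleParam]
    field_simp
    push_cast
    ring
  rw [hform, add_re, add_re, neg_re, re_ofReal_mul, re_ofReal_mul, mul_re, saddleParam_re,
    saddleParam_im, sub_re, sub_im, log_re, log_re, log_im, log_im]
  simp only [I_mul_re, sub_im, pow_two, mul_im]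
  ring

theorem log_norm_sub_log_norm_le {x y : ℂ} (hx : x ≠ 0) (hy : y ≠ 0) :
    Real.log ‖x‖ - Real.log ‖y‖ ≤ (‖x‖ ^ 2 / ‖y‖ ^ 2 - 1) / 2 := by
  have hratio : 0 < ‖x‖ / ‖y‖ := div_pos (norm_pos_iff.2 hx) (norm_pos_iff.2 hy)
  have hlog := Real.log_le_sub_one_of_pos (pow_pos hratio 2)
  rw [Real.log_pow, Real.log_div (norm_ne_zero_iff.2 hx) (norm_ne_zero_iff.2 hy), div_pow] at hlog
  push_cast at hlog
  linarith

theorem zeta8_mul_sub_mul_I_ne_zero (a : ℝ) (hb : 0 < b) : zeta8 * (a - b * I) ≠ 0 := by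
  rw [← norm_ne_zero_iff, ← pow_ne_zero_iff two_ne_zero, norm_zeta8_mul_sub_mul_I_sq]
  positivity

theorem relExponent_zeta8_mul_re_le (hβ : 0 < β) (hαβ : β ≤ α) (hb : 0 < b) (m a : ℝ) :
    (relExponent (zeta8 * (α - β * I)) m (zeta8 * (a - b * I))).re ≤
      π * (rotatedExponent α β a b - √2 / 2 * m * (a - b - (α - β))) := by
  have hη := zeta8_mul_sub_mul_I_ne_zero α hβ
  have hlog := log_norm_sub_log_norm_le (zeta8_mul_sub_mul_I_ne_zero a hb) hη
  have hre_mul_im (a b : ℝ) :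
      √2 / 2 * (a + b) * (√2 / 2 * (a - b)) = (a ^ 2 - b ^ 2) / 2 := by
    linear_combination ((a ^ 2 - b ^ 2) / 4) * Real.sq_sqrt zero_le_two
  have hre_sq_sub_im_sq : (√2 / 2 * (α + β)) ^ 2 - (√2 / 2 * (α - β)) ^ 2 = 2 * (α * β) := by
    linear_combination (α * β) * Real.sq_sqrt zero_le_two
  have hcoeff : 0 ≤ 4 * π * ((α ^ 2 - β ^ 2) / 2) := by
    have : 0 ≤ α ^ 2 - β ^ 2 := sub_nonneg.2 (by gcongr)
    positivity
  have hradial := mul_le_mul_of_nonneg_left hlog hcoeff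
  rw [norm_zeta8_mul_sub_mul_I_sq, norm_zeta8_mul_sub_mul_I_sq] at hradial
  have hident : 4 * π * ((α ^ 2 - β ^ 2) / 2) * (((a ^ 2 + b ^ 2) / (α ^ 2 + β ^ 2) - 1) / 2) -
      2 * π * ((a ^ 2 - b ^ 2) / 2 - (α ^ 2 - β ^ 2) / 2) =
      π * (2 / (α ^ 2 + β ^ 2) * (α ^ 2 * b ^ 2 - β ^ 2 * a ^ 2)) := by
    have : α ^ 2 + β ^ 2 ≠ 0 := by positivity
    field_simp
    ring
  rw [relExponent_re hη, arg_zeta8_mul_sub_mul_I a hb, arg_zeta8_mul_sub_mul_I α hβ,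
    rotatedExponent]
  simp only [zeta8_mul_sub_mul_I_re, zeta8_mul_sub_mul_I_im, hre_mul_im, hre_sq_sub_im_sq]
  linarith

theorem exists_eq_zeta8_mul_of_le_norm_sq (h0 : 0 < η.im) (h1 : η.im < η.re)
    (hS : 4 * (η.re * η.im) ≤ ‖η‖ ^ 2) :
    ∃ α β : ℝ, η = zeta8 * (α - β * I) ∧ 0 < β ∧ β ≤ α ∧
      3 / 8 * (α ^ 2 + β ^ 2) ≤ α * β ∧ α ^ 2 + β ^ 2 ≤ 4 * β ^ 2 := by
  have hsqrt : √2 ^ 2 = 2 := Real.sq_sqrt zero_le_two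
  obtain ⟨α, hα⟩ : ∃ α, α = √2 / 2 * (η.re + η.im) := ⟨_, rfl⟩
  obtain ⟨β, hβ⟩ : ∃ β, β = √2 / 2 * (η.re - η.im) := ⟨_, rfl⟩
  have hη : η = zeta8 * (α - β * I) := by rw [hα, hβ]; exact eq_zeta8_mul η
  have hnorm : α ^ 2 + β ^ 2 = ‖η‖ ^ 2 := by rw [hη, norm_zeta8_mul_sub_mul_I_sq]
  have hmul : α * β = (η.re ^ 2 - η.im ^ 2) / 2 := by
    rw [hα, hβ]
    linear_combination ((η.re ^ 2 - η.im ^ 2) / 4) * hsqrt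
  have hsub : α ^ 2 - β ^ 2 = 2 * (η.re * η.im) := by
    rw [hα, hβ]
    linear_combination (η.re * η.im) * hsqrt
  refine ⟨α, β, hη, ?_, ?_, by linarith [three_fourths_norm_sq_le h0.le h1.le hS], by linarith⟩
  · have : 0 < η.re - η.im := sub_pos.2 h1
    rw [hβ]
    positivity
  · rw [hα, hβ]
    gcongr
    linarith

theorem relExponent_line_re_le (h0 : 0 < η.im) (h1 : η.im < η.re)
    (hS : 4 * (η.re * η.im) ≤ ‖η‖ ^ 2) {m : ℝ} (hm : 0 ≤ m) (hmη : 1000 * m ≤ ‖η‖)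
    (hu : ‖η‖ ≤ 8 * |u|) : (relExponent η m (η - (m / 4 : ℝ) + zeta8 * u)).re ≤ -(u ^ 2 / 2) := by
  obtain ⟨α, β, hη, hβ0, hαβ, hprod, hβη⟩ := exists_eq_zeta8_mul_of_le_norm_sq h0 h1 hS
  obtain ⟨κ, hκ⟩ : ∃ κ, κ = √2 / 2 * (m / 4) := ⟨_, rfl⟩
  have hx : η - (m / 4 : ℝ) + zeta8 * u = zeta8 * ((α - κ + u : ℝ) - (β - κ : ℝ) * I) := by
    have hκ' := eq_zeta8_mul ((m / 4 : ℝ) : ℂ)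
    rw [ofReal_re, ofReal_im, add_zero, sub_zero, ← hκ] at hκ'
    rw [hκ', hη]
    push_cast
    ring
  have hnorm : α ^ 2 + β ^ 2 = ‖η‖ ^ 2 := by rw [hη, norm_zeta8_mul_sub_mul_I_sq]
  have hκm : κ ≤ m / 4 := by
    rw [hκ]
    nlinarith [Real.sqrt_le_iff.2 ⟨zero_le_two, (by norm_num : (2 : ℝ) ≤ 2 ^ 2)⟩]
  have hκ0 : 0 ≤ κ := by rw [hκ]; positivity
  have hηβ : ‖η‖ ≤ 2 * β := le_of_sq_le_sq (by linarith [mul_pow 2 β 2]) (by positivity)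
  have hfar : α ^ 2 + β ^ 2 ≤ 64 * u ^ 2 := by
    rw [hnorm, ← sq_abs u, show 64 * |u| ^ 2 = (8 * |u|) ^ 2 by ring]
    gcongr
  have hrotated := rotatedExponent_sub_le_of_far hκ0 (by linarith) hβ0 hαβ hprod hβη
    (by linarith) hfar
  calc (relExponent η m (η - (m / 4 : ℝ) + zeta8 * u)).re
      ≤ π * (rotatedExponent α β (α - κ + u) (β - κ) -
          √2 / 2 * m * (α - κ + u - (β - κ) - (α - β))) := by
        rw [hx]
        conv_lhs => rw [hη]
        exact relExponent_zeta8_mul_re_le hβ0 hαβ (by linarith) m _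
    _ = π * (rotatedExponent α β (α - κ + u) (β - κ) - 4 * κ * u) := by
        rw [hκ]
        ring
    _ ≤ π * -(u ^ 2 / 5) := by gcongr
    _ ≤ -(u ^ 2 / 2) := by nlinarith [Real.pi_gt_three, sq_nonneg u]

end FarExponent

section LineSaddle

variable {η : ℂ} {m u : ℝ}

theorem relQuadratic_line_re (η : ℂ) (m u : ℝ) :
    (relQuadratic η m (η - (m / 4 : ℝ) + zeta8 * u)).re = -(2 * π * u ^ 2) := by
  have hform : relQuadratic η m (η - (m / 4 : ℝ) + zeta8 * u) =
      (-(2 * π * u ^ 2) : ℝ) + (-(π * m ^ 2 / 8) : ℝ) * I := by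
    rw [relQuadratic]
    push_cast
    linear_combination (2 * (π : ℂ) * I * u ^ 2) * zeta8_sq + 2 * (π : ℂ) * u ^ 2 * I_sq
  rw [hform, add_re, ofReal_re, re_ofReal_mul, I_re, mul_zero, add_zero]

theorem norm_exp_le_of_re_le_neg_half_sq {z : ℂ} {r : ℝ} (hr : 0 < r) (hfar : r ≤ 8 * |u|)
    (hz : z.re ≤ -(u ^ 2 / 2)) : ‖exp z‖ ≤ 24 / r * Real.exp (-(1 / 8) * u ^ 2) := by
  have hexp : Real.exp ((0 + 1) ^ 2 / (4 * (3 / 8))) ≤ 3 :=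
    (Real.exp_le_exp.2 (by norm_num)).trans Real.exp_one_lt_three.le
  rw [norm_exp]
  calc Real.exp z.re
      ≤ 8 * Real.exp ((0 + 1) ^ 2 / (4 * (3 / 8))) / r * Real.exp (-(1 / 8) * u ^ 2) :=
        exp_le_div_mul_exp hr hfar (by norm_num) (by linarith)
    _ ≤ 8 * 3 / r * Real.exp (-(1 / 8) * u ^ 2) := by gcongr
    _ = 24 / r * Real.exp (-(1 / 8) * u ^ 2) := by norm_num

theorem norm_exp_relExponent_line_sub_le_of_far (h0 : 0 < η.im) (h1 : η.im < η.re)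
    (hS : 4 * (η.re * η.im) ≤ ‖η‖ ^ 2) (hm : 0 ≤ m) (hmη : 1000 * m ≤ ‖η‖)
    (hfar : ‖η‖ ≤ 8 * |u|) :
    ‖exp (relExponent η m (η - (m / 4 : ℝ) + zeta8 * u)) -
      exp (relQuadratic η m (η - (m / 4 : ℝ) + zeta8 * u))‖ ≤
      48 / ‖η‖ * Real.exp (-(1 / 8) * u ^ 2) := by
  have hη : 0 < ‖η‖ := norm_pos_iff.2 (ne_zero_of_im_pos h0)
  have hquadratic : (relQuadratic η m (η - (m / 4 : ℝ) + zeta8 * u)).re ≤ -(u ^ 2 / 2) := by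
    rw [relQuadratic_line_re]
    nlinarith [Real.pi_gt_three, sq_nonneg u]
  calc _ ≤ 24 / ‖η‖ * Real.exp (-(1 / 8) * u ^ 2) + 24 / ‖η‖ * Real.exp (-(1 / 8) * u ^ 2) :=
        (norm_sub_le _ _).trans (add_le_add
          (norm_exp_le_of_re_le_neg_half_sq hη hfar (relExponent_line_re_le h0 h1 hS hm hmη hfar))
          (norm_exp_le_of_re_le_neg_half_sq hη hfar hquadratic))
    _ = _ := by ring

theorem norm_relExponent_line_sub_relQuadratic_le (hη : 0 < η.re) (hm : 0 ≤ m)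
    (hnear : |u| + m / 4 ≤ ‖η‖ / 4) :
    ‖relExponent η m (η - (m / 4 : ℝ) + zeta8 * u) -
      relQuadratic η m (η - (m / 4 : ℝ) + zeta8 * u)‖ ≤
      π * (4 * |u| ^ 3 + m ^ 3 / 16) / ‖η‖ := by
  have hdist : ‖η - (m / 4 : ℝ) + zeta8 * u - η‖ ≤ |u| + m / 4 := by
    calc ‖η - (m / 4 : ℝ) + zeta8 * u - η‖ = ‖zeta8 * u - (m / 4 : ℝ)‖ := by congr 1; ring
      _ ≤ ‖zeta8 * u‖ + ‖((m / 4 : ℝ) : ℂ)‖ := norm_sub_le _ _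
      _ = |u| + m / 4 := by
        rw [norm_mul, norm_zeta8, one_mul, norm_real, norm_real, Real.norm_eq_abs,
          Real.norm_of_nonneg (by positivity)]
  have hcube : (|u| + m / 4) ^ 3 ≤ 4 * |u| ^ 3 + m ^ 3 / 16 := by
    have : 0 ≤ (|u| + m / 4) * (|u| - m / 4) ^ 2 := by positivity
    linarith
  calc _ ≤ π * ‖η - (m / 4 : ℝ) + zeta8 * u - η‖ ^ 3 / ‖η‖ :=
        norm_relExponent_sub_relQuadratic_le hη (hdist.trans hnear) m
    _ ≤ π * (|u| + m / 4) ^ 3 / ‖η‖ := by gcongr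
    _ ≤ _ := by gcongr

theorem cubic_le_mul_exp_abs (hm : 1 ≤ m) (u : ℝ) :
    π * (4 * |u| ^ 3 + m ^ 3 / 16) ≤ 80 * m ^ 3 * Real.exp |u| := by
  have hm3 : 1 ≤ m ^ 3 := one_le_pow₀ hm
  have hexp : 1 ≤ Real.exp |u| := Real.one_le_exp (abs_nonneg u)
  calc π * (4 * |u| ^ 3 + m ^ 3 / 16) ≤ 3.15 * (4 * (6 * Real.exp |u|) + m ^ 3 / 16) := by
        gcongr
        · exact Real.pi_lt_d2.le
        · exact cube_le_exp (abs_nonneg u)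
    _ ≤ 3.15 * (4 * (6 * (m ^ 3 * Real.exp |u|)) + m ^ 3 * Real.exp |u| / 16) := by
        gcongr
        · exact le_mul_of_one_le_left (by positivity) hm3
        · exact le_mul_of_one_le_right (by positivity) hexp
    _ = (3.15 * (24 + 1 / 16)) * (m ^ 3 * Real.exp |u|) := by ring
    _ ≤ 80 * (m ^ 3 * Real.exp |u|) := by gcongr; norm_num
    _ = 80 * m ^ 3 * Real.exp |u| := by ring

theorem cubic_div_norm_le (hη : 0 < ‖η‖) (hm3 : m ^ 3 ≤ ‖η‖) (hu : 8 * |u| ≤ ‖η‖) :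
    π * (4 * |u| ^ 3 + m ^ 3 / 16) / ‖η‖ ≤ π / 2 * u ^ 2 + 1 := by
  rw [div_le_iff₀ hη]
  have hcube : |u| ^ 3 ≤ u ^ 2 * (‖η‖ / 8) := by
    rw [← sq_abs u, pow_succ]
    gcongr
    linarith
  calc π * (4 * |u| ^ 3 + m ^ 3 / 16) ≤ π * (4 * (u ^ 2 * (‖η‖ / 8)) + ‖η‖ / 16) := by gcongr
    _ ≤ (π / 2 * u ^ 2 + 1) * ‖η‖ := by nlinarith [Real.pi_lt_four]

theorem norm_exp_relExponent_line_sub_le_of_near (h0 : 0 < η.im) (h1 : η.im < η.re)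
    (hm : 1 ≤ m) (hmη : 1000 * m ≤ ‖η‖) (hm3 : m ^ 3 ≤ ‖η‖) (hnear : 8 * |u| ≤ ‖η‖) :
    ‖exp (relExponent η m (η - (m / 4 : ℝ) + zeta8 * u)) -
      exp (relQuadratic η m (η - (m / 4 : ℝ) + zeta8 * u))‖ ≤
      720 * m ^ 3 / ‖η‖ * Real.exp (-(1 / 8) * u ^ 2) := by
  have hη : 0 < ‖η‖ := norm_pos_iff.2 (ne_zero_of_im_pos h0)
  have hdiff := norm_relExponent_line_sub_relQuadratic_le (h0.trans h1) (by linarith : 0 ≤ m)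
    (u := u) (by linarith)
  have hexponent : -(2 * π * u ^ 2) + |u| + (π / 2 * u ^ 2 + 1) ≤ 1 + 1 + -(1 / 8) * u ^ 2 := by
    nlinarith [sq_abs u, sq_nonneg (|u| - 1 / 2), Real.pi_gt_three, sq_nonneg u]
  calc _ ≤ Real.exp (-(2 * π * u ^ 2)) *
        (π * (4 * |u| ^ 3 + m ^ 3 / 16) / ‖η‖ * Real.exp (π / 2 * u ^ 2 + 1)) := by
        refine (norm_exp_sub_exp_le _ _).trans ?_
        rw [relQuadratic_line_re]
        gcongr
        exact hdiff.trans (cubic_div_norm_le hη hm3 hnear)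
    _ ≤ Real.exp (-(2 * π * u ^ 2)) *
        (80 * m ^ 3 * Real.exp |u| / ‖η‖ * Real.exp (π / 2 * u ^ 2 + 1)) := by
        gcongr _ * (?_ / _ * _)
        exact cubic_le_mul_exp_abs hm u
    _ = 80 * m ^ 3 / ‖η‖ * Real.exp (-(2 * π * u ^ 2) + |u| + (π / 2 * u ^ 2 + 1)) := by
        rw [Real.exp_add (_ + _), Real.exp_add _ |u|]
        ring
    _ ≤ 80 * m ^ 3 / ‖η‖ * Real.exp (1 + 1 + -(1 / 8) * u ^ 2) := by gcongr
    _ = 80 * (Real.exp 1 * Real.exp 1) * m ^ 3 / ‖η‖ * Real.exp (-(1 / 8) * u ^ 2) := by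
        rw [Real.exp_add, Real.exp_add]
        ring
    _ ≤ 80 * (3 * 3) * m ^ 3 / ‖η‖ * Real.exp (-(1 / 8) * u ^ 2) := by
        have := Real.exp_one_lt_three.le
        gcongr
    _ = _ := by norm_num

theorem norm_exp_relExponent_line_sub_le (h0 : 0 < η.im) (h1 : η.im < η.re)
    (hS : 4 * (η.re * η.im) ≤ ‖η‖ ^ 2) (hm : 1 ≤ m) (hmη : 1000 * m ≤ ‖η‖)
    (hm3 : m ^ 3 ≤ ‖η‖) (u : ℝ) :
    ‖exp (relExponent η m (η - (m / 4 : ℝ) + zeta8 * u)) -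
      exp (relQuadratic η m (η - (m / 4 : ℝ) + zeta8 * u))‖ ≤
      720 * m ^ 3 / ‖η‖ * Real.exp (-(1 / 8) * u ^ 2) := by
  rcases le_total ‖η‖ (8 * |u|) with hfar | hnear
  · refine (norm_exp_relExponent_line_sub_le_of_far h0 h1 hS (by linarith) hmη hfar).trans ?_
    gcongr
    linarith [one_le_pow₀ hm (n := 3)]
  · exact norm_exp_relExponent_line_sub_le_of_near h0 h1 hm hmη hm3 hnear

end LineSaddle

section LineTerm

variable {s η : ℂ} {m : ℝ}

/-- The analogue of `rayTerm s m` for the full line through `0` in the direction `zeta8`. -/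
noncomputable def lineTerm (s : ℂ) (m : ℝ) : ℂ :=
  (∫ u : ℝ, auxMode s m (zeta8 * u)) * zeta8

theorem auxMode_ne_zero {x : ℂ} (hx : x ≠ 0) : auxMode s m x ≠ 0 :=
  mul_ne_zero (auxNumer_ne_zero hx) (exp_ne_zero _)

theorem lineTerm_eq_integral_line (ht : 0 ≤ s.im) (hs : s.re < 0) (hm : 0 ≤ m) {z : ℂ}
    (hz : z.im ≤ z.re) : Integrable (fun u : ℝ => auxMode s m (z + zeta8 * u)) ∧
      lineTerm s m = (∫ u : ℝ, auxMode s m (z + zeta8 * u)) * zeta8 := by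
  obtain ⟨a, ha⟩ : ∃ a, a = √2 / 2 * (z.re + z.im) := ⟨_, rfl⟩
  obtain ⟨b, hb⟩ : ∃ b, b = √2 / 2 * (z.re - z.im) := ⟨_, rfl⟩
  have hb0 : 0 ≤ b := hb ▸ mul_nonneg (by positivity) (sub_nonneg.2 hz)
  have hpoint (u : ℝ) : zeta8 * (((u + a : ℝ) : ℂ) - b * I) = z + zeta8 * u := by
    conv_rhs => rw [eq_zeta8_mul z, ← ha, ← hb]
    push_cast
    ring
  have hG := isGaussianOnLowerStrip_auxMode ht hs hm b
  have hshift := integral_add_right_eq_self (μ := volume)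
    (fun u : ℝ => auxMode s m (zeta8 * (u - b * I))) a
  have hint := (hG.integrable_sub_mul_I hb0).comp_add_right a
  simp only [hpoint] at hshift hint
  exact ⟨hint, by rw [lineTerm, ← hG.integral_sub_mul_I hb0, hshift]⟩

theorem zeta8_re_pos : 0 < zeta8.re := by
  rw [← mul_one zeta8, zeta8_mul_re, one_re, one_im]
  positivity

theorem zeta8_im_pos : 0 < zeta8.im := by
  rw [← mul_one zeta8, zeta8_mul_im, one_re, one_im]
  positivity

theorem add_zeta8_mul_ne_zero {z : ℂ} (hz : z.im < z.re) (u : ℝ) : z + zeta8 * u ≠ 0 := by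
  intro h
  have hre := congrArg re h
  have him := congrArg im h
  rw [add_re, zeta8_mul_re, ofReal_re, ofReal_im, zero_re] at hre
  rw [add_im, zeta8_mul_im, ofReal_re, ofReal_im, zero_im] at him
  linarith

theorem norm_div_four_le_re_sub_im (h1 : η.im ≤ η.re) (hS : 4 * (η.re * η.im) ≤ ‖η‖ ^ 2) :
    ‖η‖ / 4 ≤ η.re - η.im := by
  have hsub : 0 ≤ η.re - η.im := sub_nonneg.2 h1
  have hsq : (‖η‖ / 4) ^ 2 ≤ (η.re - η.im) ^ 2 := by
    linarith [norm_sq_eq_re_sq_add_im_sq η, sq_nonneg ‖η‖]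
  exact le_of_sq_le_sq hsq hsub

theorem norm_lineTerm_sub_saddleTerm_le (h0 : 0 < η.im) (h1 : η.im < η.re)
    (hS : 4 * (η.re * η.im) ≤ ‖η‖ ^ 2) (hm : 1 ≤ m) (hmη : 1000 * m ≤ ‖η‖)
    (hm3 : m ^ 3 ≤ ‖η‖) :
    ‖lineTerm (saddleParam η) m - saddleTerm η m‖ ≤
      ‖auxMode (saddleParam η) m η‖ * (4320 * m ^ 3 / ‖η‖) := by
  have hη := ne_zero_of_im_pos h0
  have hre_mul_im : 0 < η.re * η.im := mul_pos (h0.trans h1) h0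
  have hsre : (saddleParam η).re < 0 := by
    rw [saddleParam_re]
    exact neg_neg_of_pos (by positivity)
  have hbelow : (η - (m / 4 : ℝ)).im < (η - (m / 4 : ℝ)).re := by
    rw [sub_im, sub_re, ofReal_im, ofReal_re]
    linarith [norm_div_four_le_re_sub_im h1.le hS]
  obtain ⟨hint, hline⟩ := lineTerm_eq_integral_line (saddleParam_im_nonneg h0 h1) hsre
    (by linarith : 0 ≤ m) hbelow.le
  simp only [auxMode_eq_mul_exp_relExponent hη (add_zeta8_mul_ne_zero hbelow _) m] at hint hline
  have hquadratic := integrable_exp_relQuadratic zeta8_im_pos zeta8_re_pos η m (η - (m / 4 : ℝ))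
  have hgauss := integral_exp_relQuadratic zeta8_im_pos zeta8_re_pos η m (η - (m / 4 : ℝ))
  have hmeas : AEStronglyMeasurable fun u : ℝ =>
      exp (relExponent η m (η - (m / 4 : ℝ) + zeta8 * u)) := by
    refine ((hint.const_mul (auxMode (saddleParam η) m η)⁻¹).congr ?_).aestronglyMeasurable
    exact .of_forall fun u => inv_mul_cancel_left₀ (auxMode_ne_zero hη) _
  have hsqrt : √(π / (1 / 8)) ≤ 6 := by
    refine Real.sqrt_le_iff.2 ⟨by norm_num, ?_⟩
    linarith [Real.pi_lt_four]
  rw [hline, saddleTerm, ← hgauss, integral_const_mul, mul_assoc, ← mul_sub, ← sub_mul, norm_mul,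
    norm_mul, norm_zeta8, mul_one]
  gcongr
  calc _ ≤ 720 * m ^ 3 / ‖η‖ * √(π / (1 / 8)) :=
        norm_integral_sub_integral_le (c := 0) (by norm_num) hmeas hquadratic fun u => by
          rw [sub_zero]
          exact norm_exp_relExponent_line_sub_le h0 h1 hS hm hmη hm3 u
    _ ≤ 720 * m ^ 3 / ‖η‖ * 6 := by gcongr
    _ = _ := by ring

theorem tail_line_exponent_le (h0 : 0 < η.im) (h1 : η.im < η.re)
    (hS : 4 * (η.re * η.im) ≤ ‖η‖ ^ 2) (hm : 1 ≤ m) (hmη : 1000 * m ≤ ‖η‖) {u : ℝ} (hu : 0 < u) :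
    -(saddleParam η).re * (u / ‖η‖ - 1) + (-(3 / 4 * π * (saddleParam η).im) - π * u ^ 2) +
      π * (m * (√2 / 2 * u)) + 2 * π * (η.re * η.im) ≤
      -(π * (m * η.im)) + -‖η‖ + -(π / 2) * u ^ 2 := by
  have hη : 0 < ‖η‖ := norm_pos_iff.2 (ne_zero_of_im_pos h0)
  have hre_mul_im : 0 < η.re * η.im := mul_pos (h0.trans h1) h0
  have hthree := three_fourths_norm_sq_le h0.le h1.le hS
  rw [saddleParam_re, saddleParam_im, neg_neg]
  have hradial : 4 * π * (η.re * η.im) * (u / ‖η‖) ≤ π * (‖η‖ * u) := by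
    calc 4 * π * (η.re * η.im) * (u / ‖η‖) = π * (4 * (η.re * η.im)) * (u / ‖η‖) := by ring
      _ ≤ π * ‖η‖ ^ 2 * (u / ‖η‖) := by gcongr
      _ = π * (‖η‖ * u) := by field_simp
  have hangular : π * (3 * ‖η‖ ^ 2) ≤ 3 / 4 * π * (2 * π * (η.re ^ 2 - η.im ^ 2)) := by
    calc π * (3 * ‖η‖ ^ 2) ≤ 3 / 4 * π * (2 * 3 * (3 / 4 * ‖η‖ ^ 2)) := by
          nlinarith [mul_pos Real.pi_pos (pow_pos hη 2)]
      _ ≤ _ := by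
        gcongr
        exact Real.pi_gt_three.le
  have hmode_u : π * (m * (√2 / 2 * u)) ≤ π * (‖η‖ / 1000 * u) := by
    have hsqrt : √2 / 2 ≤ 1 := by
      linarith [Real.sqrt_le_iff.2 ⟨zero_le_two, (by norm_num : (2 : ℝ) ≤ 2 ^ 2)⟩]
    calc π * (m * (√2 / 2 * u)) ≤ π * (‖η‖ / 1000 * (1 * u)) := by
          gcongr
          linarith
      _ = _ := by rw [one_mul]
  have hmode_im : π * (m * η.im) ≤ π * (‖η‖ / 1000 * ‖η‖) := by
    gcongr
    · linarith
    · exact im_le_norm η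
  have hnorm : ‖η‖ ≤ π * ‖η‖ ^ 2 := by nlinarith [Real.pi_gt_three]
  have hamgm : π * (1001 / 1000 * (‖η‖ * u)) ≤ π * (1 / 2 * u ^ 2 + 0.6 * ‖η‖ ^ 2) := by
    gcongr
    nlinarith [sq_nonneg (‖η‖ - u)]
  linarith [mul_pos Real.pi_pos hre_mul_im, mul_pos Real.pi_pos (pow_pos hη 2)]

theorem norm_auxMode_neg_zeta8_mul_le (h0 : 0 < η.im) (h1 : η.im < η.re)
    (hS : 4 * (η.re * η.im) ≤ ‖η‖ ^ 2) (hm : 1 ≤ m) (hmη : 1000 * m ≤ ‖η‖) {u : ℝ} (hu : 0 < u) :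
    ‖auxMode (saddleParam η) m (zeta8 * (-u : ℝ))‖ ≤
      ‖auxMode (saddleParam η) m η‖ * Real.exp (-‖η‖) * Real.exp (-(π / 2) * (u - 0) ^ 2) := by
  have hη : 0 < ‖η‖ := norm_pos_iff.2 (ne_zero_of_im_pos h0)
  have hk : 0 ≤ -(saddleParam η).re := by
    have : 0 < η.re * η.im := mul_pos (h0.trans h1) h0
    rw [saddleParam_re, neg_neg]
    positivity
  set k := -(saddleParam η).re
  set w := -(3 / 4 * π * (saddleParam η).im) - π * u ^ 2
  have him : (zeta8 * (-u : ℝ)).im = -(√2 / 2 * u) := by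
    rw [zeta8_mul_im, ofReal_re, ofReal_im]
    ring
  have hlower := rpow_mul_exp_le_norm_auxNumer h0 (saddleParam_im_nonneg h0 h1)
  rw [auxMode, auxMode, norm_mul, norm_mul, norm_auxNumer_neg_zeta8_mul _ hu, norm_exp_pi_I_mul,
    norm_exp_pi_I_mul, im_ofReal_mul, im_ofReal_mul, him]
  calc u ^ k * Real.exp w * Real.exp (-(π * (m * -(√2 / 2 * u))))
      ≤ ‖η‖ ^ k * Real.exp (k * (u / ‖η‖ - 1)) * Real.exp w *
        Real.exp (-(π * (m * -(√2 / 2 * u)))) := by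
        gcongr
        exact rpow_le_rpow_mul_exp hu.le hη hk
    _ = ‖η‖ ^ k * Real.exp (-(2 * π * (η.re * η.im))) *
        Real.exp (k * (u / ‖η‖ - 1) + w + π * (m * (√2 / 2 * u)) + 2 * π * (η.re * η.im)) := by
        simp only [mul_assoc (‖η‖ ^ k), ← Real.exp_add]
        ring_nf
    _ ≤ ‖auxNumer (saddleParam η) η‖ *
        Real.exp (-(π * (m * η.im)) + -‖η‖ + -(π / 2) * u ^ 2) := by
        refine mul_le_mul hlower (Real.exp_le_exp.2 ?_) (by positivity) (by positivity)
        exact tail_line_exponent_le h0 h1 hS hm hmη hu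
    _ = _ := by
        rw [Real.exp_add, Real.exp_add, sub_zero]
        ring

theorem lineTerm_sub_rayTerm (ht : 0 ≤ s.im) (hs : s.re < 0) (hm : 0 ≤ m) :
    lineTerm s m - rayTerm s m =
      (∫ u in Ioi (0 : ℝ), auxMode s m (zeta8 * (-u : ℝ))) * zeta8 := by
  have hint := (isGaussianOnLowerStrip_auxMode ht hs hm 0).integrable le_rfl
  have hreflect := integral_comp_neg_Ioi 0 fun u : ℝ => auxMode s m (zeta8 * u)
  rw [neg_zero] at hreflect
  rw [lineTerm, rayTerm, ← intervalIntegral.integral_Iic_add_Ioi hint.integrableOn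
    hint.integrableOn (b := 0), hreflect]
  ring

theorem norm_lineTerm_sub_rayTerm_le (h0 : 0 < η.im) (h1 : η.im < η.re)
    (hS : 4 * (η.re * η.im) ≤ ‖η‖ ^ 2) (hm : 1 ≤ m) (hmη : 1000 * m ≤ ‖η‖) :
    ‖lineTerm (saddleParam η) m - rayTerm (saddleParam η) m‖ ≤
      ‖auxMode (saddleParam η) m η‖ * (2 / ‖η‖) := by
  have hη : 0 < ‖η‖ := norm_pos_iff.2 (ne_zero_of_im_pos h0)
  have hsre : (saddleParam η).re < 0 := by
    rw [saddleParam_re]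
    have : 0 < η.re * η.im := mul_pos (h0.trans h1) h0
    exact neg_neg_of_pos (by positivity)
  have hsqrt : √(π / (π / 2)) ≤ 2 := by
    refine Real.sqrt_le_iff.2 ⟨by norm_num, ?_⟩
    field_simp
    norm_num
  have hexp : Real.exp (-‖η‖) ≤ 1 / ‖η‖ := by
    rw [Real.exp_neg, one_div]
    gcongr
    linarith [Real.add_one_le_exp ‖η‖]
  rw [lineTerm_sub_rayTerm (saddleParam_im_nonneg h0 h1) hsre (by linarith), norm_mul, norm_zeta8,
    mul_one]
  calc _ ≤ ‖auxMode (saddleParam η) m η‖ * Real.exp (-‖η‖) * √(π / (π / 2)) :=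
        norm_integral_Ioi_gaussian_le (by positivity) (by positivity) fun u hu =>
          norm_auxMode_neg_zeta8_mul_le h0 h1 hS hm hmη hu
    _ ≤ ‖auxMode (saddleParam η) m η‖ * (1 / ‖η‖) * 2 := by gcongr
    _ = _ := by ring

theorem norm_rayTerm_sub_saddleTerm_le_of_le_norm_sq (h0 : 0 < η.im) (h1 : η.im < η.re)
    (hS : 4 * (η.re * η.im) ≤ ‖η‖ ^ 2) (hm : 1 ≤ m) (hmη : 1000 * m ≤ ‖η‖)
    (hm3 : m ^ 3 ≤ ‖η‖) :
    ‖rayTerm (saddleParam η) m - saddleTerm η m‖ ≤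
      ‖auxMode (saddleParam η) m η‖ * (5000 * m ^ 3 / ‖η‖) := by
  have hη : 0 < ‖η‖ := norm_pos_iff.2 (ne_zero_of_im_pos h0)
  have hm3' : 1 ≤ m ^ 3 := one_le_pow₀ hm
  have htail := norm_lineTerm_sub_rayTerm_le h0 h1 hS hm hmη
  rw [norm_sub_rev] at htail
  calc ‖rayTerm (saddleParam η) m - saddleTerm η m‖
      ≤ ‖auxMode (saddleParam η) m η‖ * (2 / ‖η‖) +
        ‖auxMode (saddleParam η) m η‖ * (4320 * m ^ 3 / ‖η‖) :=
        (norm_sub_le_norm_sub_add_norm_sub _ _ _).trans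
          (add_le_add htail (norm_lineTerm_sub_saddleTerm_le h0 h1 hS hm hmη hm3))
    _ = ‖auxMode (saddleParam η) m η‖ * ((2 + 4320 * m ^ 3) / ‖η‖) := by ring
    _ ≤ _ := by
      gcongr
      linarith

end LineTerm

section SaddlePhase

/-- The phase `exp (-(π * I * m ^ 2 / 8))` of `saddleTerm η m` at the odd number `m = 2 * k + 1`. -/
noncomputable def saddlePhase (k : ℕ) : ℂ :=
  exp (-((π : ℂ) * I * (2 * k + 1) ^ 2 / 8))

theorem norm_saddlePhase (k : ℕ) : ‖saddlePhase k‖ = 1 := by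
  rw [saddlePhase, show -((π : ℂ) * I * (2 * k + 1) ^ 2 / 8) =
    (-(π * (2 * k + 1) ^ 2 / 8) : ℝ) * I by push_cast; ring, norm_exp_ofReal_mul_I]

theorem saddlePhase_one : saddlePhase 1 = -saddlePhase 0 := by
  rw [saddlePhase, saddlePhase, show -((π : ℂ) * I * (2 * (1 : ℕ) + 1) ^ 2 / 8) =
    -((π : ℂ) * I * (2 * (0 : ℕ) + 1) ^ 2 / 8) - (π : ℂ) * I by push_cast; ring, exp_sub,
    exp_pi_mul_I, div_neg, div_one]

theorem saddlePhase_add_two (k : ℕ) : saddlePhase (k + 2) = -saddlePhase k := by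
  rw [saddlePhase, saddlePhase, show -((π : ℂ) * I * (2 * (k + 2 : ℕ) + 1) ^ 2 / 8) =
    -((π : ℂ) * I * (2 * k + 1) ^ 2 / 8) - (π : ℂ) * I + (-(k + 1) : ℤ) * (2 * (π : ℂ) * I) by
    push_cast; ring, exp_periodic.int_mul, exp_sub, exp_pi_mul_I, div_neg, div_one]

theorem saddleTerm_odd (η : ℂ) (k : ℕ) : saddleTerm η (2 * k + 1) =
    auxNumer (saddleParam η) η * (zeta8 / √2) *
      (saddlePhase k * exp ((π : ℂ) * I * η) ^ (2 * k + 1)) := by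
  rw [saddleTerm, auxMode, saddlePhase, ← exp_nat_mul]
  push_cast
  ring_nf

theorem one_add_pow_mul_sum_saddlePhase (q : ℂ) (K : ℕ) :
    (1 + q ^ 4) * ∑ k ∈ Finset.range K, saddlePhase k * q ^ (2 * k + 1) =
      saddlePhase 0 * (q - q ^ 3) - saddlePhase K * q ^ (2 * K + 1) -
        saddlePhase (K + 1) * q ^ (2 * K + 3) := by
  induction K with
  | zero =>
    rw [Finset.sum_range_zero, saddlePhase_one]
    ring
  | succ n ih =>
    rw [Finset.sum_range_succ, mul_add, ih, saddlePhase_add_two]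
    ring

theorem le_norm_sum_saddlePhase {q : ℂ} (hq : ‖q‖ ≤ 1) (K : ℕ) :
    (‖q‖ * (1 - ‖q‖ ^ 2) - 2 * ‖q‖ ^ (2 * K + 1)) / 2 ≤
      ‖∑ k ∈ Finset.range K, saddlePhase k * q ^ (2 * k + 1)‖ := by
  set S := ∑ k ∈ Finset.range K, saddlePhase k * q ^ (2 * k + 1)
  have hfactor : ‖1 + q ^ 4‖ ≤ 2 := by
    calc ‖1 + q ^ 4‖ ≤ ‖(1 : ℂ)‖ + ‖q ^ 4‖ := norm_add_le _ _
      _ ≤ 1 + 1 := by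
        rw [norm_one, norm_pow]
        gcongr
        exact pow_le_one₀ (norm_nonneg q) hq
      _ = 2 := one_add_one_eq_two
  have hnorm (k n : ℕ) : ‖saddlePhase k * q ^ n‖ = ‖q‖ ^ n := by
    rw [norm_mul, norm_saddlePhase, one_mul, norm_pow]
  have hfirst : ‖q‖ * (1 - ‖q‖ ^ 2) ≤ ‖saddlePhase 0 * (q - q ^ 3)‖ := by
    rw [norm_mul, norm_saddlePhase, one_mul]
    calc ‖q‖ * (1 - ‖q‖ ^ 2) = ‖q‖ - ‖q ^ 3‖ := by rw [norm_pow]; ring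
      _ ≤ ‖q - q ^ 3‖ := norm_sub_norm_le _ _
  have hlast : ‖q‖ ^ (2 * K + 3) ≤ ‖q‖ ^ (2 * K + 1) :=
    pow_le_pow_of_le_one (norm_nonneg q) hq (by lia)
  have htelescope : ‖q‖ * (1 - ‖q‖ ^ 2) - 2 * ‖q‖ ^ (2 * K + 1) ≤ ‖(1 + q ^ 4) * S‖ := by
    rw [one_add_pow_mul_sum_saddlePhase]
    linarith [hnorm K (2 * K + 1), hnorm (K + 1) (2 * K + 3),
      norm_sub_norm_le (saddlePhase 0 * (q - q ^ 3)) (saddlePhase K * q ^ (2 * K + 1)),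
      norm_sub_norm_le (saddlePhase 0 * (q - q ^ 3) - saddlePhase K * q ^ (2 * K + 1))
        (saddlePhase (K + 1) * q ^ (2 * K + 3))]
  rw [norm_mul] at htelescope
  linarith [mul_le_mul_of_nonneg_right hfactor (norm_nonneg S)]

theorem sum_cube_mul_pow_le {x : ℝ} (h0 : 0 ≤ x) (h1 : x < 1) (K : ℕ) :
    ∑ k ∈ Finset.range K, (2 * k + 1 : ℝ) ^ 3 * x ^ k ≤ 48 / (1 - x) ^ 4 := by
  have hsum := hasSum_choose_mul_geometric_of_norm_lt_one 3 (r := x)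
    (by rwa [Real.norm_of_nonneg h0])
  have hcube (k : ℕ) : (2 * k + 1 : ℝ) ^ 3 ≤ 48 * ((k + 3).choose 3 : ℕ) := by
    have hchoose : ((k + 1 : ℕ) : ℝ) ^ 3 ≤ (Nat.factorial 3 : ℕ) * ((k + 3).choose 3 : ℕ) := by
      exact_mod_cast Nat.pow_sub_le_descFactorial (k + 3) 3 |>.trans_eq
        (Nat.descFactorial_eq_factorial_mul_choose _ _)
    calc (2 * k + 1 : ℝ) ^ 3 ≤ (2 * (k + 1 : ℕ)) ^ 3 := by
          gcongr
          push_cast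
          linarith
      _ = 8 * ((k + 1 : ℕ) : ℝ) ^ 3 := by ring
      _ ≤ 8 * ((Nat.factorial 3 : ℕ) * ((k + 3).choose 3 : ℕ)) := by gcongr
      _ = 48 * ((k + 3).choose 3 : ℕ) := by norm_num [Nat.factorial]; ring
  calc ∑ k ∈ Finset.range K, (2 * k + 1 : ℝ) ^ 3 * x ^ k
      ≤ ∑ k ∈ Finset.range K, 48 * (((k + 3).choose 3 : ℕ) * x ^ k : ℝ) := by
        refine Finset.sum_le_sum fun k _ => ?_
        rw [← mul_assoc]
        gcongr
        exact hcube k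
    _ = 48 * ∑ k ∈ Finset.range K, (((k + 3).choose 3 : ℕ) * x ^ k : ℝ) := by rw [Finset.mul_sum]
    _ ≤ 48 * (1 / (1 - x) ^ 4) := by
        rw [← hsum.tsum_eq]
        gcongr
        exact hsum.summable.sum_le_tsum _ fun k _ => by positivity
    _ = 48 / (1 - x) ^ 4 := mul_one_div _ _

end SaddlePhase

section DominantSum

variable {s η : ℂ} {K : ℕ}

theorem riemannAux_ne_zero_of_norm_lt {S : ℂ} (ht : 0 ≤ s.im) (hs : s.re < -1)
    (h : ‖∑ k ∈ Finset.range K, rayTerm s (2 * k + 1) - S‖ + ‖rayTail s K‖ + ‖lowerPart s‖ < ‖S‖) :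
    riemannAux s ≠ 0 := by
  intro hzero
  rw [riemannAux_eq_sum_rayTerm_sub ht hs K] at hzero
  set T := ∑ k ∈ Finset.range K, rayTerm s (2 * k + 1)
  have hS : S = rayTail s K + lowerPart s - (T - S) := by linear_combination hzero
  have hnorm : ‖S‖ ≤ ‖rayTail s K‖ + ‖lowerPart s‖ + ‖T - S‖ := by
    nth_rewrite 1 [hS]
    exact (norm_sub_le _ _).trans (add_le_add_left (norm_add_le _ _) _)
  linarith

theorem half_le_norm_zeta8_div_sqrt_two : 1 / 2 ≤ ‖zeta8 / √2‖ := by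
  rw [norm_div, norm_zeta8, norm_real, Real.norm_of_nonneg (Real.sqrt_nonneg 2)]
  gcongr
  exact Real.sqrt_le_iff.2 ⟨by norm_num, by norm_num⟩

theorem norm_auxMode (s η : ℂ) (m : ℝ) :
    ‖auxMode s m η‖ = ‖auxNumer s η‖ * Real.exp (-(m * (π * η.im))) := by
  rw [auxMode, norm_mul, norm_exp_pi_I_mul, im_ofReal_mul, mul_left_comm]

theorem norm_lowerPart_le_auxMode (h0 : 0 < η.im) (h1 : η.im < η.re) (h2 : 1 ≤ η.re * η.im) :
    ‖lowerPart (saddleParam η)‖ ≤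
      ‖auxMode (saddleParam η) 1 η‖ * (40 * Real.exp (-(saddleParam η).im)) := by
  refine (norm_lowerPart_le h0 h1 h2).trans_eq ?_
  rw [norm_auxMode, one_mul]
  ring

end DominantSum

section DiagonalSaddle

variable {η : ℂ}

theorem norm_auxMode_le_two_mul_norm_saddleTerm (η : ℂ) (m : ℝ) :
    ‖auxMode (saddleParam η) m η‖ ≤ 2 * ‖saddleTerm η m‖ := by
  have hphase : ‖exp (-((π : ℂ) * I * m ^ 2 / 8))‖ = 1 := by
    rw [show -((π : ℂ) * I * m ^ 2 / 8) = ((-(π * m ^ 2 / 8) : ℝ) : ℂ) * I by push_cast; ring,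
      norm_exp_ofReal_mul_I]
  rw [saddleTerm, norm_mul, norm_mul, hphase, mul_one]
  linarith [mul_le_mul_of_nonneg_left half_le_norm_zeta8_div_sqrt_two
    (norm_nonneg (auxMode (saddleParam η) m η))]

theorem norm_rayTail_one_le (h0 : 0 < η.im) (h1 : η.im < η.re) (hη : ‖η‖ ≤ 4 * η.im)
    (hr : 200 ≤ ‖η‖) :
    ‖rayTail (saddleParam η) 1‖ ≤ ‖auxMode (saddleParam η) 1 η‖ / 10 := by
  have hpi := Real.pi_gt_three
  have hratio : ‖η‖ / η.im ≤ 4 := by rwa [div_le_iff₀ h0]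
  have hdecay : Real.exp (-(π * η.im / 2)) ≤ 1 / 40 := by
    rw [Real.exp_neg, one_div]
    gcongr
    nlinarith [Real.add_one_le_exp (π * η.im / 2)]
  calc ‖rayTail (saddleParam η) 1‖
      ≤ ‖auxNumer (saddleParam η) η‖ * (‖η‖ / η.im) *
          Real.exp (-(3 / 2 * π * (1 : ℕ) * η.im)) :=
        norm_rayTail_le h0 h1 (by nlinarith) (by push_cast; linarith)
    _ = ‖auxMode (saddleParam η) 1 η‖ * ((‖η‖ / η.im) * Real.exp (-(π * η.im / 2))) := by
        rw [norm_auxMode, show -(3 / 2 * π * (1 : ℕ) * η.im) =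
          -(1 * (π * η.im)) + -(π * η.im / 2) by push_cast; ring, Real.exp_add]
        ring
    _ ≤ ‖auxMode (saddleParam η) 1 η‖ * (4 * (1 / 40)) := by gcongr
    _ = ‖auxMode (saddleParam η) 1 η‖ / 10 := by ring

theorem riemannAux_ne_zero_of_norm_sq_le (h0 : 0 < η.im) (h1 : η.im < η.re)
    (hS : ‖η‖ ^ 2 ≤ 4 * (η.re * η.im)) (hr : 1000000 ≤ ‖η‖) (ht : 6 ≤ (saddleParam η).im) :
    riemannAux (saddleParam η) ≠ 0 := by
  have him : ‖η‖ ≤ 4 * η.im := by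
    have : η.re * η.im ≤ ‖η‖ * η.im := by gcongr; exact re_le_norm η
    nlinarith
  have hprod : 1 ≤ η.re * η.im := by nlinarith
  have hM : 0 < ‖auxMode (saddleParam η) 1 η‖ :=
    norm_pos_iff.2 (auxMode_ne_zero (ne_zero_of_im_pos h0))
  have hmain := norm_auxMode_le_two_mul_norm_saddleTerm η 1
  have hsaddle : ‖rayTerm (saddleParam η) 1 - saddleTerm η 1‖ ≤
      ‖auxMode (saddleParam η) 1 η‖ * (1 / 10) := by
    refine (norm_rayTerm_sub_saddleTerm_le h0 h1 hS).trans ?_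
    refine mul_le_mul_of_nonneg_left ?_ hM.le
    have hexp : Real.exp 5 ≤ 3 ^ 5 := by
      rw [show (5 : ℝ) = (5 : ℕ) by norm_num, ← Real.exp_one_pow]
      gcongr
      exact Real.exp_one_lt_three.le
    rw [div_le_iff₀ (by linarith)]
    linarith
  have htail := norm_rayTail_one_le h0 h1 him (by linarith)
  have hlower : ‖lowerPart (saddleParam η)‖ ≤
      ‖auxMode (saddleParam η) 1 η‖ * (40 * (1 / 320)) := by
    refine (norm_lowerPart_le_auxMode h0 h1 hprod).trans ?_
    rw [Real.exp_neg, one_div]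
    gcongr
    have hexp : 2.7 ^ 6 ≤ Real.exp 6 := by
      rw [show (6 : ℝ) = (6 : ℕ) by norm_num, ← Real.exp_one_pow]
      gcongr
      linarith [Real.exp_one_gt_d9]
    linarith [Real.exp_le_exp.2 ht]
  refine riemannAux_ne_zero_of_norm_lt (K := 1) (S := saddleTerm η 1)
    (saddleParam_im_nonneg h0 h1) (saddleParam_re_lt_neg_one hprod) ?_
  rw [Finset.sum_range_one, Nat.cast_zero, mul_zero, zero_add]
  linarith

end DiagonalSaddle

section RealAxisSaddle

variable {η : ℂ} {r : ℝ} {K : ℕ}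

theorem norm_sum_rayTerm_sub_saddleTerm_le (h0 : 0 < η.im) (h1 : η.im < η.re)
    (hS : 4 * (η.re * η.im) ≤ ‖η‖ ^ 2) (hK : 1000 * (2 * K) ≤ ‖η‖) (hK3 : (2 * K) ^ 3 ≤ ‖η‖) :
    ‖∑ k ∈ Finset.range K, rayTerm (saddleParam η) (2 * k + 1) -
        ∑ k ∈ Finset.range K, saddleTerm η (2 * k + 1)‖ ≤
      ‖auxMode (saddleParam η) 1 η‖ *
        (240000 / (‖η‖ * (1 - Real.exp (-(π * η.im)) ^ 2) ^ 4)) := by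
  set q := Real.exp (-(π * η.im)) with hq
  have hq1 : q < 1 := by rw [hq, Real.exp_lt_one_iff]; nlinarith [Real.pi_pos]
  have hmode (k : ℕ) : ‖auxMode (saddleParam η) (2 * k + 1) η‖ =
      ‖auxMode (saddleParam η) 1 η‖ * (q ^ 2) ^ k := by
    rw [norm_auxMode, norm_auxMode, mul_assoc, hq, ← pow_mul, ← Real.exp_nat_mul, ← Real.exp_add]
    congr 2
    push_cast
    ring
  rw [← Finset.sum_sub_distrib]
  calc ‖∑ k ∈ Finset.range K, (rayTerm (saddleParam η) (2 * k + 1) - saddleTerm η (2 * k + 1))‖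
      ≤ ∑ k ∈ Finset.range K, ‖auxMode (saddleParam η) 1 η‖ * (5000 / ‖η‖) *
          ((2 * k + 1) ^ 3 * (q ^ 2) ^ k) := by
        refine norm_sum_le_of_le _ fun k hk => ?_
        have hkK : (2 * k + 1 : ℝ) ≤ 2 * K := by
          exact_mod_cast (by have := Finset.mem_range.1 hk; omega : 2 * k + 1 ≤ 2 * K)
        refine (norm_rayTerm_sub_saddleTerm_le_of_le_norm_sq h0 h1 hS (m := 2 * k + 1)
          (le_add_of_nonneg_left (by positivity)) (by linarith)
          (hK3.trans' (by gcongr))).trans_eq ?_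
        rw [hmode]
        ring
    _ ≤ ‖auxMode (saddleParam η) 1 η‖ * (5000 / ‖η‖) * (48 / (1 - q ^ 2) ^ 4) := by
        rw [← Finset.mul_sum]
        gcongr
        exact sum_cube_mul_pow_le (by positivity) (by nlinarith [Real.exp_pos (-(π * η.im))]) K
    _ = ‖auxMode (saddleParam η) 1 η‖ * (240000 / (‖η‖ * (1 - q ^ 2) ^ 4)) := by
        rw [mul_assoc, div_mul_div_comm]
        norm_num

theorem mul_norm_auxMode_le_norm_sum_saddleTerm (h0 : 0 ≤ η.im) (K : ℕ) :
    ‖auxMode (saddleParam η) 1 η‖ *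
        ((1 - Real.exp (-(π * η.im)) ^ 2 - 2 * Real.exp (-(π * η.im)) ^ (2 * K)) / 4) ≤
      ‖∑ k ∈ Finset.range K, saddleTerm η (2 * k + 1)‖ := by
  set q := exp ((π : ℂ) * I * η)
  have hnorm : ‖q‖ = Real.exp (-(π * η.im)) := norm_exp_pi_I_mul η
  have hq1 : ‖q‖ ≤ 1 := by
    rw [hnorm, Real.exp_le_one_iff]
    nlinarith [Real.pi_pos]
  simp_rw [saddleTerm_odd]
  rw [← Finset.mul_sum, norm_mul, norm_mul, norm_auxMode, one_mul, ← hnorm]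
  calc ‖auxNumer (saddleParam η) η‖ * ‖q‖ * ((1 - ‖q‖ ^ 2 - 2 * ‖q‖ ^ (2 * K)) / 4)
      = ‖auxNumer (saddleParam η) η‖ * (1 / 2) *
          ((‖q‖ * (1 - ‖q‖ ^ 2) - 2 * ‖q‖ ^ (2 * K + 1)) / 2) := by ring
    _ ≤ ‖auxNumer (saddleParam η) η‖ * (1 / 2) *
          ‖∑ k ∈ Finset.range K, saddlePhase k * q ^ (2 * k + 1)‖ := by
        gcongr
        exact le_norm_sum_saddlePhase hq1 K
    _ ≤ _ := by
        gcongr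
        exact half_le_norm_zeta8_div_sqrt_two

theorem norm_rayTail_le_auxMode (h0 : 0 < η.im) (h1 : η.im < η.re) (h2 : 1 ≤ η.re * η.im)
    (hK : 1 ≤ K) (hKη : K ≤ η.re / 2) (hlog : 2 * Real.log ‖η‖ ≤ K * η.im) :
    ‖rayTail (saddleParam η) K‖ ≤
      ‖auxMode (saddleParam η) 1 η‖ * (1 / ‖η‖) := by
  have hη : 0 < ‖η‖ := norm_pos_iff.2 (ne_zero_of_im_pos h0)
  have hdecay : -(3 / 2 * π * K * η.im) ≤ -(1 * (π * η.im)) + -((3 : ℕ) * Real.log ‖η‖) := by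
    have hfirst : π * η.im ≤ π * (K * η.im) := by
      gcongr
      exact le_mul_of_one_le_left h0.le (by exact_mod_cast hK)
    have hrest : 3 * (2 * Real.log ‖η‖) ≤ π * (K * η.im) :=
      mul_le_mul Real.pi_gt_three.le hlog
        (by have := Real.log_nonneg (one_le_norm_of_one_le_re_mul_im h2); positivity) Real.pi_pos.le
    push_cast
    linarith
  calc ‖rayTail (saddleParam η) K‖
      ≤ ‖auxNumer (saddleParam η) η‖ * (‖η‖ / η.im) * Real.exp (-(3 / 2 * π * K * η.im)) :=
        norm_rayTail_le h0 h1 h2 hKη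
    _ ≤ ‖auxNumer (saddleParam η) η‖ * (‖η‖ / η.im) *
          (Real.exp (-(1 * (π * η.im))) * (‖η‖ ^ 3)⁻¹) := by
        rw [← Real.exp_log hη, ← Real.exp_nat_mul, Real.exp_log hη, ← Real.exp_neg, ← Real.exp_add]
        gcongr
    _ = ‖auxMode (saddleParam η) 1 η‖ * (1 / (‖η‖ * η.im * ‖η‖)) := by
        rw [norm_auxMode]
        field_simp
    _ ≤ ‖auxMode (saddleParam η) 1 η‖ * (1 / ‖η‖) := by
        gcongr
        exact le_mul_of_one_le_left hη.le
          (h2.trans (mul_le_mul_of_nonneg_right (re_le_norm η) h0.le))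

theorem norm_lowerPart_le_div_norm (h0 : 0 < η.im) (h1 : η.im < η.re) (h2 : 1 ≤ η.re * η.im)
    (hS : 4 * (η.re * η.im) ≤ ‖η‖ ^ 2) :
    ‖lowerPart (saddleParam η)‖ ≤ ‖auxMode (saddleParam η) 1 η‖ * (40 * (1 / ‖η‖)) := by
  have hη := one_le_norm_of_one_le_re_mul_im h2
  refine (norm_lowerPart_le_auxMode h0 h1 h2).trans ?_
  rw [Real.exp_neg, one_div]
  gcongr
  have him : ‖η‖ ≤ (saddleParam η).im :=
    (le_self_pow₀ hη two_ne_zero).trans (norm_sq_le_saddleParam_im h0.le h1.le hS)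
  linarith [Real.add_one_le_exp (saddleParam η).im]

theorem exp_neg_pi_mul_pow_le {y : ℝ} (hr : 1 ≤ r) (h : 2 * Real.log r ≤ K * y) :
    Real.exp (-(π * y)) ^ (2 * K) ≤ 1 / r := by
  have hlog := Real.log_nonneg hr
  rw [one_div, ← Real.exp_log (inv_pos.2 (zero_lt_one.trans_le hr)), Real.log_inv,
    ← Real.exp_nat_mul]
  gcongr
  push_cast
  nlinarith [mul_le_mul_of_nonneg_left h Real.pi_pos.le, Real.pi_gt_three]

theorem exists_nat_le_mul_of_le_mul {x y ρ : ℝ} (hx : 0 < x) (hy : 0 < y) (hρ : 1 ≤ ρ)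
    (h : x ≤ ρ * y) : ∃ K : ℕ, 1 ≤ K ∧ (K : ℝ) ≤ 3 * ρ ∧ 2 * x ≤ K * y := by
  refine ⟨⌈2 * x / y⌉₊, Nat.one_le_ceil_iff.2 (by positivity), ?_, ?_⟩
  · have hdiv : 2 * x / y ≤ 2 * ρ := by rw [div_le_iff₀ hy]; linarith
    linarith [Nat.ceil_lt_add_one (show 0 ≤ 2 * x / y by positivity)]
  · rw [← div_le_iff₀ hy]
    exact Nat.le_ceil _

theorem le_one_sub_exp_sq {x y : ℝ} (hx0 : 0 ≤ x) (hx : x ≤ 1 / 2) (hxy : x ≤ y) :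
    x ≤ 1 - Real.exp (-(π * y)) ^ 2 := by
  have hxpi : x ≤ π * y := hxy.trans (le_mul_of_one_le_left (hx0.trans hxy)
    (by linarith [Real.pi_gt_three]))
  have hexp : Real.exp (-(π * y)) ^ 2 ≤ (1 + 2 * x)⁻¹ := by
    rw [← Real.exp_nat_mul, mul_neg, Real.exp_neg]
    gcongr
    push_cast
    linarith [Real.add_one_le_exp (2 * (π * y))]
  have hinv : (1 + 2 * x)⁻¹ ≤ 1 - x := by
    rw [inv_le_iff_one_le_mul₀ (by positivity)]
    nlinarith
  linarith

/-- The conclusion is governed by `r * d ^ 5`, the error of the sum of the saddle terms being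
`O(1 / (r * d ^ 4))` against a main term of size `d`. -/
theorem div_mul_pow_le {L r ρ d : ℝ} (hL : 40 ≤ L) (hρ : 0 < ρ) (hr : r = ρ ^ 5)
    (hd : L / ρ ≤ d) : 240000 / (r * d ^ 4) ≤ d / 100 := by
  have hd0 : 0 < d := hd.trans_lt' (by positivity)
  have hLd : 40 ^ 5 ≤ r * d ^ 5 := by
    rw [div_le_iff₀ hρ] at hd
    calc (40 : ℝ) ^ 5 ≤ (d * ρ) ^ 5 := by gcongr; linarith
      _ = r * d ^ 5 := by rw [hr]; ring
  rw [hr, div_le_iff₀ (by positivity), ← hr]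
  linarith

theorem half_norm_le_re (h0 : 0 < η.im) (h1 : η.im < η.re)
    (hS : 4 * (η.re * η.im) ≤ ‖η‖ ^ 2) : ‖η‖ / 2 ≤ η.re := by
  refine le_of_sq_le_sq ?_ (h0.trans h1).le
  nlinarith [three_fourths_norm_sq_le h0.le h1.le hS, sq_nonneg η.im]

theorem riemannAux_ne_zero_of_cutoff (h0 : 0 < η.im) (h1 : η.im < η.re) (h2 : 1 ≤ η.re * η.im)
    (hS : 4 * (η.re * η.im) ≤ ‖η‖ ^ 2) (hK : 1 ≤ K) (hKη : 1000 * (2 * K) ≤ ‖η‖)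
    (hK3 : (2 * K) ^ 3 ≤ ‖η‖) (hlog : 2 * Real.log ‖η‖ ≤ K * η.im)
    (h : 240000 / (‖η‖ * (1 - Real.exp (-(π * η.im)) ^ 2) ^ 4) + 42 * (1 / ‖η‖) <
      (1 - Real.exp (-(π * η.im)) ^ 2) / 4) :
    riemannAux (saddleParam η) ≠ 0 := by
  have hη : 0 < 1 / ‖η‖ := one_div_pos.2 (norm_pos_iff.2 (ne_zero_of_im_pos h0))
  have hmode : 0 < ‖auxMode (saddleParam η) 1 η‖ :=
    norm_pos_iff.2 (auxMode_ne_zero (ne_zero_of_im_pos h0))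
  have hre := half_norm_le_re h0 h1 hS
  have hsum := norm_sum_rayTerm_sub_saddleTerm_le h0 h1 hS hKη hK3
  have htail := norm_rayTail_le_auxMode h0 h1 h2 hK (by linarith) hlog
  have hlower := norm_lowerPart_le_div_norm h0 h1 h2 hS
  have hmain := mul_norm_auxMode_le_norm_sum_saddleTerm h0.le K
  have hcut := exp_neg_pi_mul_pow_le (one_le_norm_of_one_le_re_mul_im h2) hlog
  refine riemannAux_ne_zero_of_norm_lt (K := K) (saddleParam_im_nonneg h0 h1)
    (saddleParam_re_lt_neg_one h2) ((add_le_add_three hsum htail hlower).trans_lt ?_)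
  rw [← mul_add, ← mul_add]
  refine (mul_lt_mul_of_pos_left ?_ hmode).trans_le hmain
  linarith

theorem riemannAux_ne_zero_of_le_norm_sq {ρ : ℝ} (h0 : 0 < η.im) (h1 : η.im < η.re)
    (hS : 4 * (η.re * η.im) ≤ ‖η‖ ^ 2) (hr : ‖η‖ = ρ ^ 5) (hlog : 40 ≤ Real.log ‖η‖)
    (hlogρ : 2 * Real.log ‖η‖ ≤ ρ) (hy : Real.log ‖η‖ ≤ ρ * η.im) :
    riemannAux (saddleParam η) ≠ 0 := by
  have hρ : 80 ≤ ρ := by linarith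
  have hη3 : 80 ^ 2 * ρ ^ 3 ≤ ‖η‖ := by
    rw [hr, show ρ ^ 5 = ρ ^ 2 * ρ ^ 3 by ring]
    gcongr
  have hη1 : 80 ^ 4 * ρ ≤ ‖η‖ := by
    rw [hr, show ρ ^ 5 = ρ ^ 4 * ρ by ring]
    gcongr
  have hprod : 1 ≤ η.re * η.im := by
    have : ρ * η.im ≤ η.re * η.im := by gcongr; linarith [half_norm_le_re h0 h1 hS]
    linarith
  obtain ⟨K, hK, hKρ, hKlog⟩ := exists_nat_le_mul_of_le_mul (by linarith) h0 (by linarith) hy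
  have hK3 : (2 * K : ℝ) ^ 3 ≤ ‖η‖ := by
    calc (2 * K : ℝ) ^ 3 ≤ (2 * (3 * ρ)) ^ 3 := by gcongr
      _ ≤ ‖η‖ := by nlinarith
  refine riemannAux_ne_zero_of_cutoff h0 h1 hprod hS hK (by linarith) hK3 hKlog ?_
  have hd : Real.log ‖η‖ / ρ ≤ 1 - Real.exp (-(π * η.im)) ^ 2 := by
    refine le_one_sub_exp_sq (by positivity) ?_ ?_ <;> rw [div_le_iff₀ (by positivity)] <;> linarith
  have hsum := div_mul_pow_le hlog (by positivity) hr hd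
  set d := 1 - Real.exp (-(π * η.im)) ^ 2
  have hinv : 1 / ‖η‖ ≤ d / 4000 := by
    rw [div_le_iff₀ (by positivity)] at hd
    rw [div_le_div_iff₀ (by linarith) (by norm_num)]
    nlinarith
  have hd0 : 0 < d := hd.trans_lt' (by positivity)
  linarith

end RealAxisSaddle

section Growth

variable {s η : ℂ}

theorem exists_eq_saddleParam (hre : s.re < 0) (him : 0 < s.im) :
    ∃ η : ℂ, s = saddleParam η ∧ 0 < η.im ∧ η.im < η.re := by
  have hpi := Real.pi_pos
  obtain ⟨w, hw⟩ := IsAlgClosed.exists_pow_nat_eq (s / (2 * (π : ℂ) * I)) two_pos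
  obtain ⟨η, hη, h0⟩ : ∃ η : ℂ, η ^ 2 = s / (2 * (π : ℂ) * I) ∧ 0 ≤ η.re := by
    rcases le_total 0 w.re with h | h
    · exact ⟨w, hw, h⟩
    · exact ⟨-w, by rw [neg_sq, hw], neg_nonneg.2 h⟩
  obtain rfl : s = saddleParam η := by rw [saddleParam, hη, mul_div_cancel₀ _ two_pi_I_ne_zero]
  rw [saddleParam_re] at hre
  rw [saddleParam_im] at him
  have hprod : 0 < η.re * η.im := by nlinarith
  have hη0 : 0 < η.im := pos_of_mul_pos_right hprod h0
  have hsq : 0 < η.re ^ 2 - η.im ^ 2 := pos_of_mul_pos_right him (by positivity)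
  exact ⟨η, rfl, hη0, lt_of_pow_lt_pow_left₀ 2 h0 (sub_pos.1 hsq)⟩

theorem exists_log_le_rpow :
    ∃ r₀ : ℝ, 10 ^ 10 ≤ r₀ ∧ ∀ r, r₀ ≤ r →
      40 ≤ Real.log r ∧ 2 * Real.log r ≤ r ^ (1 / 5 : ℝ) := by
  have hlog := Real.tendsto_log_atTop.eventually_ge_atTop 40
  have hrpow := (isLittleO_log_rpow_atTop (show (0 : ℝ) < 1 / 5 by norm_num)).bound
    (show (0 : ℝ) < 1 / 2 by norm_num)
  obtain ⟨b, hb⟩ := eventually_atTop.1 (hlog.and hrpow)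
  refine ⟨max (10 ^ 10) b, le_max_left _ _, fun r hr => ?_⟩
  obtain ⟨h40, hlt⟩ := hb r ((le_max_right _ _).trans hr)
  have hr0 : 0 ≤ r := le_trans (by positivity) ((le_max_left _ _).trans hr)
  rw [Real.norm_of_nonneg (by linarith), Real.norm_of_nonneg (by positivity)] at hlt
  exact ⟨h40, by linarith⟩

theorem exists_mul_rpow_mul_log_lt {A a b c : ℝ} (hA : 0 < A) (ha : 0 < a) (hbc : b < c) :
    ∃ t₁ : ℝ, ∀ t : ℝ, t₁ ≤ t → A * t ^ b * Real.log t < a * t ^ c := by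
  have hbound := (isLittleO_log_rpow_atTop (sub_pos.2 hbc)).bound
    (show 0 < a / (2 * A) by positivity)
  obtain ⟨t₁, ht₁⟩ := eventually_atTop.1 hbound
  refine ⟨max 1 t₁, fun t ht => ?_⟩
  have ht1 : 1 ≤ t := (le_max_left _ _).trans ht
  have hlog := ht₁ t ((le_max_right _ _).trans ht)
  rw [Real.norm_of_nonneg (Real.log_nonneg ht1), Real.norm_of_nonneg (by positivity)] at hlog
  calc A * t ^ b * Real.log t ≤ A * t ^ b * (a / (2 * A) * t ^ (c - b)) := by gcongr
    _ = a * t ^ c / 2 := by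
        rw [Real.rpow_sub (by linarith)]
        field_simp
    _ < a * t ^ c := half_lt_self (by positivity)

theorem saddleParam_im_le_mul_norm_sq (η : ℂ) : (saddleParam η).im ≤ 7 * ‖η‖ ^ 2 := by
  rw [saddleParam_im, norm_sq_eq_re_sq_add_im_sq]
  nlinarith [sq_nonneg η.im, sq_nonneg η.re, Real.pi_lt_d2, Real.pi_pos]

/-- Write `ρ = ‖η‖ ^ (1 / 5)`, so that `t ≥ ‖η‖ ^ 2` gives `t ^ (2 / 5) ≥ ρ ^ 4`, while
`- Re s = 4 π (re η) (im η)` is at most `4 π ρ ^ 5 im η`. -/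
theorem log_norm_le_mul_im (h0 : 0 < η.im) (h1 : η.im < η.re)
    (hS : 4 * (η.re * η.im) ≤ ‖η‖ ^ 2) (hlog : 1 ≤ Real.log ‖η‖)
    (h : 7 * (saddleParam η).im ^ (2 / 5 : ℝ) * Real.log (saddleParam η).im ≤
      1 - (saddleParam η).re) :
    Real.log ‖η‖ ≤ ‖η‖ ^ (1 / 5 : ℝ) * η.im := by
  have hη : 0 < ‖η‖ := norm_pos_iff.2 (ne_zero_of_im_pos h0)
  have hη1 : 1 ≤ ‖η‖ := by
    rw [← Real.exp_log hη]
    exact Real.one_le_exp (by linarith)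
  have him := norm_sq_le_saddleParam_im h0.le h1.le hS
  set ρ := ‖η‖ ^ (1 / 5 : ℝ) with hρ
  have hρ1 : 1 ≤ ρ := Real.one_le_rpow hη1 (by norm_num)
  have hρ5 : ρ ^ 5 = ‖η‖ := by
    rw [hρ, ← Real.rpow_mul_natCast hη.le]
    norm_num
  have him0 : 0 ≤ (saddleParam η).im := him.trans' (by positivity)
  have hρ4 : ρ ^ 4 ≤ (saddleParam η).im ^ (2 / 5 : ℝ) := by
    calc ρ ^ 4 = (‖η‖ ^ 2) ^ (2 / 5 : ℝ) := by
          rw [hρ, ← Real.rpow_mul_natCast hη.le, ← Real.rpow_natCast_mul hη.le]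
          norm_num
      _ ≤ (saddleParam η).im ^ (2 / 5 : ℝ) := by gcongr
  have hlog2 : 2 * Real.log ‖η‖ ≤ Real.log (saddleParam η).im := by
    rw [← Nat.cast_ofNat, ← Real.log_pow]
    exact Real.log_le_log (by positivity) him
  have hle : ρ ^ 4 * Real.log ‖η‖ * 14 ≤ 1 + 4 * 3.15 * (ρ ^ 4 * (ρ * η.im)) := by
    calc ρ ^ 4 * Real.log ‖η‖ * 14 = 7 * ρ ^ 4 * (2 * Real.log ‖η‖) := by ring
      _ ≤ 7 * (saddleParam η).im ^ (2 / 5 : ℝ) * Real.log (saddleParam η).im := by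
          gcongr
      _ ≤ 1 + 4 * π * (η.re * η.im) := by rwa [saddleParam_re, sub_neg_eq_add] at h
      _ ≤ 1 + 4 * 3.15 * (‖η‖ * η.im) := by
          gcongr
          · exact mul_nonneg (h0.trans h1).le h0.le
          · exact Real.pi_lt_d2.le
          · exact re_le_norm η
      _ = 1 + 4 * 3.15 * (ρ ^ 4 * (ρ * η.im)) := by rw [← hρ5]; ring
  have hone : 1 ≤ ρ ^ 4 * Real.log ‖η‖ :=
    one_le_mul_of_one_le_of_one_le (one_le_pow₀ hρ1) hlog
  exact le_of_mul_le_mul_left (by linarith) (show 0 < ρ ^ 4 by positivity)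

theorem neg_of_mul_rpow_mul_log_le {t σ : ℝ} (ht : 3 ≤ t)
    (h : 7 * t ^ (2 / 5 : ℝ) * Real.log t ≤ 1 - σ) : σ < 0 := by
  have hlog : 1 ≤ Real.log t := by
    rw [Real.le_log_iff_exp_le (by linarith)]
    exact Real.exp_one_lt_three.le.trans ht
  have hrpow : 1 ≤ t ^ (2 / 5 : ℝ) := Real.one_le_rpow (by linarith) (by norm_num)
  linarith [one_le_mul_of_one_le_of_one_le hrpow hlog]

end Growth

end

theorem mainTheorem3 :
    ∃ t₀ A : ℝ, 0 < t₀ ∧ 0 < A ∧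
      (∀ s : ℂ, t₀ ≤ s.im →
        A * s.im ^ (2 / 5 : ℝ) * Real.log s.im ≤ 1 - s.re → riemannAux s ≠ 0) ∧
      (∀ a : ℝ, 0 < a → ∃ t₁ : ℝ, ∀ t : ℝ, t₁ ≤ t →
        A * t ^ (2 / 5 : ℝ) * Real.log t < a * t ^ (3 / 7 : ℝ)) := by
  obtain ⟨r₀, hr₀, hlog⟩ := exists_log_le_rpow
  refine ⟨7 * r₀ ^ 2, 7, by positivity, by norm_num, fun s ht hσ => ?_,
    fun a ha => exists_mul_rpow_mul_log_lt (by norm_num) ha (by norm_num)⟩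
  have ht6 : 6 ≤ s.im := by nlinarith
  obtain ⟨η, rfl, h0, h1⟩ := exists_eq_saddleParam
    (neg_of_mul_rpow_mul_log_le (by linarith) hσ) (by linarith)
  have hr : r₀ ≤ ‖η‖ := le_of_sq_le_sq
    (by linarith [saddleParam_im_le_mul_norm_sq η]) (norm_nonneg η)
  rcases le_total (‖η‖ ^ 2) (4 * (η.re * η.im)) with hS | hS
  · exact riemannAux_ne_zero_of_norm_sq_le h0 h1 hS (by linarith) ht6
  · obtain ⟨hlog40, hlogρ⟩ := hlog ‖η‖ hr
    have hρ : ‖η‖ = (‖η‖ ^ (1 / 5 : ℝ)) ^ 5 := by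
      rw [← Real.rpow_mul_natCast (norm_nonneg η)]
      norm_num
    exact riemannAux_ne_zero_of_le_norm_sq h0 h1 hS hρ hlog40 hlogρ
      (log_norm_le_mul_im h0 h1 hS (by linarith) hσ)
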